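/- Let $n\ge 0$, $k\ge 1$, and let $Q=M_1+\dots+M_k\subset\mathbb R^n$ be an admissible Minkowski decomposition: each $M_i$ is a lattice polytope having the origin as a vertex, and its non-zero vertices $v_{i,1},\dots,v_{i,m_i}$ can be completed to a $\mathbb Z$-basis of $\mathbb Z^n$. Let $Y_\sigma=\operatorname{Spec}\mathbb C[\sigma^\vee\cap\mathbb Z^{n+1}]$ be the affine toric variety of the cone $\sigma=C(Q)=\{\lambda(q,1):\lambda\ge 0,\ q\in Q\}$, and let $Y_{\widetilde\sigma}=\operatorname{Spec}\mathbb C[\widetilde\sigma^\vee\cap\mathbb Z^{n+k}]$, where $\widetilde\sigma\subset\mathbb R^n\times\mathbb R^k$ is the cone generated by the points $(q,e_i)$ with $1\le i\le k$ and $q\in M_i\cap\mathbb Z^n$. Let $t_i=\chi^{(0,e_i)}$ and $\Psi=(t_1-t_2,\dots,t_1-t_k):Y_{\widetilde\sigma}\to\mathbb C^{k-1}$. Let $\epsilon_1=0$ and $\epsilon=(\epsilon_2,\dots,\epsilon_k)\in\mathbb C^{k-1}$ with $\epsilon_1,\dots,\epsilon_k$ pairwise distinct; put $Y_{\widetilde\sigma,\epsilon}=\Psi^{-1}(\epsilon)$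 and let $f:Y_{\widetilde\sigma,\epsilon}\to\mathbb C$ be the projection to $t_1$. Fibres are scheme-theoretic. Then: 1. $\Psi$ is flat and $\Psi^{-1}(0)\cong Y_\sigma$ over $\mathbb C$, so $Y_{\widetilde\sigma,\epsilon}$ is a deformation of $Y_\sigma$. 2. For $c\in\mathbb C\setminus\{\epsilon_1,\dots,\epsilon_k\}$ the fibre $f^{-1}(c)$ is isomorphic to $(\mathbb C^*)^n$; moreover, over $\mathbb C\setminus\{\epsilon_1,\dots,\epsilon_k\}$ the map $f$ is isomorphic to the trivial bundle with fibre $(\mathbb C^*)^n$. 3. For each $i$, the fibre $f^{-1}(\epsilon_i)$ attached to $M_i$ is isomorphic to the subvariety $\{x_0x_1\cdots x_{m_i}=0\}\subset\mathbb C^{m_i+1}\times(\mathbb C^*)^{n-m_i}$; moreover, over $\mathbb C\setminus\{\epsilon_j:j\ne i\}$ the map $f$ is isomorphic to the restriction of the map $\epsilon_i+x_0x_1\cdots x_{m_i}:\mathbb C^{m_i+1}\times(\mathbb C^*)^{n-m_i}\to\mathbb C$. 4. The singular (i.e. non-smooth) fibres of $f$ are exactly the fibres over those $\epsilon_i$ with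 $M_i\neq\{0\}$; in particular, if no $M_i$ equals $\{0\}$, there are exactly $k$ singular fibres. 5. $Y_{\widetilde\sigma,\epsilon}$ is smooth. -/

import Mathlib

open AlgebraicGeometry CategoryTheory
open scoped Pointwise

noncomputable section

namespace Altmann

/-! ### Polytopes, cones and toric varieties -/

/-- The real vector with the given integer coordinates. -/
def toReal {I : Type} (m : I → ℤ) : I → ℝ := fun i => (m i : ℝ)

/-- The condition on each summand of an admissible Minkowski decomposition: `P` is a lattice
polytope, the origin is a vertex of `P`, and the non-zero vertices of `P` are
members of a `ℤ`-basis of the lattice `ℤ^n`. -/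
structure IsUnimodularSimplex {n : ℕ} (P : Set (Fin n → ℝ)) : Prop where
  isLatticePolytope : ∃ s : Finset (Fin n → ℤ), P = convexHull ℝ (toReal '' (s : Set (Fin n → ℤ)))
  zero_vertex : (0 : Fin n → ℝ) ∈ Set.extremePoints ℝ P
  vertices_basis : ∃ (b : Module.Basis (Fin n) ℤ (Fin n → ℤ)) (J : Set (Fin n)),
    Set.extremePoints ℝ P \ {0} = (fun j => toReal (b j)) '' J

/-- The number of non-zero vertices of `P`. -/
def numVertices {n : ℕ} (P : Set (Fin n → ℝ)) : ℕ := (Set.extremePoints ℝ P \ {0}).ncard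

/-- The cone `C(Q) = {l (q, 1) | l ≥ 0, q ∈ Q}` in `ℝ^n × ℝ`. -/
def coneOver {n : ℕ} (Q : Set (Fin n → ℝ)) : Set (Fin n ⊕ Unit → ℝ) :=
  {u | ∃ l : ℝ, 0 ≤ l ∧ ∃ q ∈ Q, u = l • Sum.elim q (fun _ => (1 : ℝ))}

/-- The cone in `ℝ^n × ℝ^k` generated by the points `(q, e_i)` with `q ∈ M_i ∩ ℤ^n`. -/
def cayleyCone {n k : ℕ} (M : Fin k → Set (Fin n → ℝ)) : Set (Fin n ⊕ Fin k → ℝ) :=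
  (PointedCone.hull ℝ {u | ∃ (i : Fin k) (q : Fin n → ℤ), toReal q ∈ M i ∧
    u = Sum.elim (toReal q) (Pi.single i (1 : ℝ))} : Set (Fin n ⊕ Fin k → ℝ))

/-- The semigroup of lattice points of the dual cone of `τ`. -/
def dualSemigroup {I : Type} [Fintype I] (τ : Set (I → ℝ)) : AddSubmonoid (I → ℤ) where
  carrier := {m | ∀ u ∈ τ, 0 ≤ ∑ i, (m i : ℝ) * u i}
  zero_mem' := by
    intro u _
    simp
  add_mem' := by
    intro a b ha hb u hu
    have h := add_nonneg (ha u hu) (hb u hu)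
    rw [← Finset.sum_add_distrib] at h
    simpa [add_mul] using h

/-- The semigroup algebra `ℂ[τ^∨ ∩ M]`. -/
abbrev ToricRing {I : Type} [Fintype I] (τ : Set (I → ℝ)) : Type :=
  AddMonoidAlgebra ℂ (dualSemigroup τ)

/-! ### Affine schemes over `ℂ` -/

/-- `Spec A`, as a scheme over `ℂ`. -/
def specOver (A : Type) [CommRing A] [Algebra ℂ A] : Over (Spec (CommRingCat.of ℂ)) :=
  Over.mk (Spec.map (CommRingCat.ofHom (algebraMap ℂ A)))

/-- The affine toric variety `Y_τ` of the cone `τ`. -/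
def toricVariety {I : Type} [Fintype I] (τ : Set (I → ℝ)) : Over (Spec (CommRingCat.of ℂ)) :=
  specOver (ToricRing τ)

/-- The affine space `ℂ^J`. -/
abbrev affineSpace (J : Type) : Scheme := Spec (CommRingCat.of (MvPolynomial J ℂ))

/-- The complex point of the affine space `ℂ^J` with coordinates `a`. -/
def point {J : Type} (a : J → ℂ) : Spec (CommRingCat.of ℂ) ⟶ affineSpace J :=
  Spec.map (CommRingCat.ofHom (MvPolynomial.eval a))

/-- The scheme-theoretic fibre of `g` over the complex point `a`, as a scheme over `ℂ`. -/
def fibre {J : Type} {X : Scheme} (g : X ⟶ affineSpace J) (a : J → ℂ) :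
    Over (Spec (CommRingCat.of ℂ)) :=
  Over.mk (Limits.pullback.snd g (point a))

/-- The morphism from `Spec A` to `ℂ^J` whose components are the functions `h j`. -/
def toAffineSpace {J : Type} {A : Type} [CommRing A] [Algebra ℂ A] (h : J → A) :
    Spec (CommRingCat.of A) ⟶ affineSpace J :=
  Spec.map (CommRingCat.ofHom (MvPolynomial.aeval (R := ℂ) h).toRingHom)

/-! ### The deformation and its projection to `t_1` -/

lemma single_mem_dualSemigroup {n k : ℕ} (M : Fin k → Set (Fin n → ℝ)) (i : Fin k) :
    Pi.single (Sum.inr i) (1 : ℤ) ∈ dualSemigroup (cayleyCone M) := by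
  intro u hu
  have key : ∀ v ∈ PointedCone.hull ℝ {u : Fin n ⊕ Fin k → ℝ | ∃ (i : Fin k) (q : Fin n → ℤ),
      toReal q ∈ M i ∧ u = Sum.elim (toReal q) (Pi.single i (1 : ℝ))}, 0 ≤ v (Sum.inr i) := by
    intro v hv
    induction hv using Submodule.span_induction with
    | mem x hx =>
      obtain ⟨j, q, _, rfl⟩ := hx
      by_cases h : i = j
      · subst h
        simp
      · simp [h]
    | zero => simp
    | add x y _ _ hx hy => simpa using add_nonneg hx hy
    | smul a x _ hx => exact mul_nonneg a.2 hx
  have h := key u hu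
  have e : ∑ j, ((Pi.single (Sum.inr i) (1 : ℤ) : Fin n ⊕ Fin k → ℤ) j : ℝ) * u j
      = u (Sum.inr i) := by
    rw [Finset.sum_eq_single (Sum.inr i)]
    · simp
    · intro b _ hb
      simp [hb]
    · simp
  rw [e]
  exact h

/-- The function `t_i` on the toric variety of the Cayley cone: the character `(0, e_i)`. -/
def t {n k : ℕ} (M : Fin k → Set (Fin n → ℝ)) (i : Fin k) : ToricRing (cayleyCone M) :=
  AddMonoidAlgebra.single ⟨Pi.single (Sum.inr i) 1, single_mem_dualSemigroup M i⟩ 1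

/-- The morphism `Ψ = (t_1 - t_i)_{i ≠ 1}` to `ℂ^{k-1}`; the first index is `0 : Fin k`. -/
def Psi {n k : ℕ} [NeZero k] (M : Fin k → Set (Fin n → ℝ)) :
    (toricVariety (cayleyCone M)).left ⟶ affineSpace {i : Fin k // i ≠ 0} :=
  toAffineSpace (fun i => t M 0 - t M i.1)

/-- The deformation `Ψ⁻¹(ε)`. The value `ε 0` plays no role here. -/
def deformation {n k : ℕ} [NeZero k] (M : Fin k → Set (Fin n → ℝ)) (ε : Fin k → ℂ) :
    Over (Spec (CommRingCat.of ℂ)) :=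
  fibre (Psi M) (fun i => ε i.1)

/-- The projection of the deformation to the coordinate `t_1`. -/
def projection {n k : ℕ} [NeZero k] (M : Fin k → Set (Fin n → ℝ)) (ε : Fin k → ℂ) :
    (deformation M ε).left ⟶ affineSpace Unit :=
  Limits.pullback.fst (Psi M) (point (fun i : {i : Fin k // i ≠ 0} => ε i.1)) ≫
    toAffineSpace (fun _ => t M 0)

/-! ### Models -/

/-- The coordinate ring of the torus `(ℂ^*)^r`: Laurent polynomials in `r` variables. -/
abbrev TorusRing (r : ℕ) : Type := AddMonoidAlgebra ℂ (Fin r → ℤ)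

/-- The coordinate ring of `ℂ^{m+1} × (ℂ^*)^r`, with coordinates `x_0, …, x_m` on `ℂ^{m+1}`. -/
abbrev ModelRing (m r : ℕ) : Type := MvPolynomial (Fin (m + 1)) (TorusRing r)

/-- The function `x_0 ⋯ x_m` on `ℂ^{m+1} × (ℂ^*)^r`. -/
def coordProd (m r : ℕ) : ModelRing m r := ∏ j, MvPolynomial.X j

/-- The subvariety `x_0 ⋯ x_m = 0` of `ℂ^{m+1} × (ℂ^*)^r`. -/
def singularModel (m r : ℕ) : Over (Spec (CommRingCat.of ℂ)) :=
  specOver (ModelRing m r ⧸ Ideal.span {coordProd m r})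

/-- The map `c + x_0 ⋯ x_m` from `ℂ^{m+1} × (ℂ^*)^r` to `ℂ`. -/
def modelMap (m r : ℕ) (c : ℂ) : Spec (CommRingCat.of (ModelRing m r)) ⟶ affineSpace Unit :=
  toAffineSpace (fun _ => algebraMap ℂ (ModelRing m r) c + coordProd m r)

/-- The projection `(ℂ^*)^n × ℂ ⟶ ℂ`. -/
def torusProjection (n : ℕ) :
    Spec (CommRingCat.of (MvPolynomial Unit (TorusRing n))) ⟶ affineSpace Unit :=
  toAffineSpace (fun i => MvPolynomial.X i)

/-- The complement in the complex line of the points `ε i`, `i ∈ s`. -/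
def lineMinus {k : ℕ} (ε : Fin k → ℂ) (s : Finset (Fin k)) : (affineSpace Unit).Opens :=
  PrimeSpectrum.basicOpen (∏ i ∈ s, (MvPolynomial.X () - MvPolynomial.C (ε i)))

end Altmann

end

/-! Everything rests on the support functions `η i u = -min_{M_i} u`. A lattice point `(u, a)` lies
in the dual of the Cayley cone iff `η i u ≤ a i` for all `i`, so the toric ring is free over `ℂ[t_1,
…, t_k]` on the minimal characters `(u, η(u))` (`exists_eq_sum`, `laurentHom_sum`, `flat_aeval_t`).
The differences `t_1 - t_i` are part of a linear coordinate system, whence `Ψ` is flat. As `η` is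
additive under Minkowski sums, `(u, a) ↦ (u, ∑ a i)` identifies the central fibre with the toric
variety of `C(Q)`.

Freeness also shows that the ideal of `Ψ⁻¹(ε)` is exactly the kernel of the map to `ℂ[t][ℤ^n]`
sending the character `(u, a)` to `χ^u ∏ (t - ε_i)^(a i)` (`mem_deformationIdeal_iff`). Hence a
homomorphism `φ` to a ring `B` through which this map factors, and which is surjective up to powers
of `φ g`, becomes an isomorphism from the deformation ring once `g` is inverted
(`isLocalization_away_deformationRing`).

There are two kinds of charts. Inverting all `t_j` gives the torus bundle. Inverting the `t_j` with
`j ≠ i` leaves the condition `η i u ≤ a i`; in coordinates adapted to the unimodular simplex `M i`,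
`η i` is the maximum of `0` and the `-v_j`, so the condition says that `a i` and all `a i + v_j` are
non-negative. These are the exponents of monomials in `x_0, …, x_m`, and `t_i` becomes `x_0 ⋯ x_m`.

Since the `ε i` are distinct, no two `t_i` vanish together, so the second kind of chart covers the
deformation and smoothness follows from that of the model. The fibres are read off from the charts,
and `x_0 ⋯ x_m = 0` is singular iff `m ≥ 1`, by an infinitesimal lifting test. -/

noncomputable section

namespace Altmann

/-! ### Support functions of unimodular simplices -/

/-- `η u` is the negative of the minimum of the integral functional `u` on `P`, and the minimum is
attained at a lattice point. -/
def IsSupport {n : ℕ} (P : Set (Fin n → ℝ)) (η : (Fin n → ℤ) → ℕ) : Prop :=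
  ∀ u : Fin n → ℤ, (∀ q ∈ P, 0 ≤ ∑ i, (u i : ℝ) * q i + η u) ∧
    ∃ q : Fin n → ℤ, toReal q ∈ P ∧ u ⬝ᵥ q + η u = 0

lemma sum_mul_toReal {n : ℕ} (u q : Fin n → ℤ) :
    ∑ i, (u i : ℝ) * toReal q i = ((u ⬝ᵥ q : ℤ) : ℝ) := by
  simp [toReal, dotProduct]

lemma toReal_injective {I : Type} : Function.Injective (toReal : (I → ℤ) → I → ℝ) := by
  intro a b h
  funext i
  exact Int.cast_injective (congrFun h i)

namespace IsUnimodularSimplex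

variable {n : ℕ} {P : Set (Fin n → ℝ)}

lemma isCompact (hP : IsUnimodularSimplex P) : IsCompact P := by
  obtain ⟨s, rfl⟩ := hP.isLatticePolytope
  exact (s.finite_toSet.image _).isCompact_convexHull ℝ

lemma convex (hP : IsUnimodularSimplex P) : Convex ℝ P := by
  obtain ⟨s, rfl⟩ := hP.isLatticePolytope
  exact convex_convexHull ℝ _

/-- Krein–Milman: a compact convex set is the closed convex hull of its extreme points. -/
lemma subset_of_extremePoints_subset (hP : IsUnimodularSimplex P) {C : Set (Fin n → ℝ)}
    (hC : Convex ℝ C) (hC' : IsClosed C) (h : Set.extremePoints ℝ P ⊆ C) : P ⊆ C := by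
  rw [← closure_convexHull_extremePoints hP.isCompact hP.convex]
  exact closure_minimal (convexHull_min h hC) hC'

lemma ne_singleton_iff (hP : IsUnimodularSimplex P) : P ≠ {0} ↔ numVertices P ≠ 0 := by
  refine not_congr ⟨fun h => ?_, fun h => ?_⟩
  · subst h
    simp [numVertices]
  · obtain ⟨b, J, hJ⟩ := hP.vertices_basis
    -- Finiteness is needed because `Set.ncard` is also `0` on infinite sets.
    have hfin : (Set.extremePoints ℝ P \ {0}).Finite := hJ ▸ J.toFinite.image _
    have h0 := (Set.ncard_eq_zero hfin).1 h
    refine Set.Subset.antisymm ?_ (Set.singleton_subset_iff.2 (extremePoints_subset hP.zero_vertex))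
    exact hP.subset_of_extremePoints_subset (convex_singleton _) isClosed_singleton
      (Set.sdiff_eq_empty.1 h0)

/-- Coordinates on the lattice of functionals in which the support function of a unimodular simplex
is the maximum of `0` and the negatives of the first coordinates. -/
lemma exists_coordinates (hP : IsUnimodularSimplex P) :
    ∃ e : (Fin n → ℤ) ≃+ (Fin (numVertices P) → ℤ) × (Fin (n - numVertices P) → ℤ),
      IsSupport P (fun u => Finset.univ.sup fun j => (-(e u).1 j).toNat) := by
  classical
  obtain ⟨b, J, hJ⟩ := hP.vertices_basis
  have hinj : Function.Injective (fun j => toReal (b j)) := toReal_injective.comp b.injective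
  have hcard : Nat.card J = numVertices P := by
    rw [numVertices, hJ, Set.ncard_image_of_injective _ hinj]
    rfl
  have hcard' : Nat.card (Jᶜ : Set (Fin n)) = n - numVertices P := by
    have := Set.ncard_add_ncard_compl J
    simp only [Nat.card_eq_fintype_card, Fintype.card_fin] at this
    change Jᶜ.ncard = _
    have h' : J.ncard = numVertices P := hcard
    omega
  -- Basis vectors that are vertices come first; the others give the torus directions. The first
  -- component of `e u` then lists the values of `u` at the non-zero vertices.
  let σ : Fin n ≃ Fin (numVertices P) ⊕ Fin (n - numVertices P) :=
    (Equiv.Set.sumCompl J).symm.trans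
      (Equiv.sumCongr (Finite.equivFinOfCardEq hcard) (Finite.equivFinOfCardEq hcard'))
  let D : (Fin n → ℤ) ≃ₗ[ℤ] (Fin n → ℤ) := dotProductEquiv ℤ (Fin n) ≪≫ₗ (b.constr ℤ).symm
  have hD : ∀ u j, D u j = u ⬝ᵥ b j := by
    intro u j
    simp [D, Module.Basis.constr]
  let e := D ≪≫ₗ LinearEquiv.funCongrLeft ℤ ℤ σ.symm ≪≫ₗ
    LinearEquiv.sumArrowLequivProdArrow _ _ ℤ ℤ
  have he : ∀ u j, (e u).1 j = u ⬝ᵥ b (σ.symm (Sum.inl j)) := fun u j => hD u _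
  have hσ : ∀ j, σ.symm (Sum.inl j) ∈ J := by
    intro j
    simp [σ]
  have hσ' : ∀ l ∈ J, ∃ j, σ.symm (Sum.inl j) = l := by
    intro l hl
    refine ⟨Finite.equivFinOfCardEq hcard ⟨l, hl⟩, ?_⟩
    simp [σ]
  refine ⟨e.toAddEquiv, fun u => ⟨?_, ?_⟩⟩
  -- The inequality is affine in `q`, so it is enough to check it at the vertices.
  · refine hP.subset_of_extremePoints_subset
      (C := {q | 0 ≤ ∑ i, (u i : ℝ) * q i + (_ : ℕ)}) ?_ ?_ ?_
    · intro x hx y hy a c ha hc hac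
      simp only [Set.mem_ofPred_eq, Pi.add_apply, Pi.smul_apply, smul_eq_mul] at hx hy ⊢
      have h1 : ∑ i, (u i : ℝ) * (a * x i + c * y i)
          = a * ∑ i, (u i : ℝ) * x i + c * ∑ i, (u i : ℝ) * y i := by
        rw [Finset.mul_sum, Finset.mul_sum, ← Finset.sum_add_distrib]
        exact Finset.sum_congr rfl fun i _ => by ring
      rw [h1]
      have h2 := add_nonneg (mul_nonneg ha hx) (mul_nonneg hc hy)
      generalize ((_ : ℕ) : ℝ) = N at h2 ⊢
      have : N = a * N + c * N := by rw [← add_mul, hac, one_mul]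
      linarith
    · exact isClosed_le continuous_const (by fun_prop)
    · intro q hq
      by_cases h0 : q = 0
      · subst h0
        simp
      · have hq' : q ∈ Set.extremePoints ℝ P \ {0} := ⟨hq, h0⟩
        rw [hJ] at hq'
        obtain ⟨l, hl, rfl⟩ := hq'
        obtain ⟨j, rfl⟩ := hσ' l hl
        have h1 : (-(e u).1 j).toNat ≤ Finset.univ.sup fun j => (-(e u).1 j).toNat :=
          Finset.le_sup (f := fun j => (-(e u).1 j).toNat) (Finset.mem_univ j)
        rw [Set.mem_ofPred_eq, sum_mul_toReal]
        rw [he] at h1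
        norm_cast
        change 0 ≤ _ + ((Finset.univ.sup fun j => (-(e u).1 j).toNat : ℕ) : ℤ)
        omega
  · change ∃ q : Fin n → ℤ, toReal q ∈ P ∧
      u ⬝ᵥ q + ((Finset.univ.sup fun j => (-(e u).1 j).toNat : ℕ) : ℤ) = 0
    -- The minimum is attained at the origin if it is `0`, and otherwise at the vertex where the
    -- supremum is reached.
    rcases Nat.eq_zero_or_pos (Finset.univ.sup fun j => (-(e u).1 j).toNat) with h | h
    · refine ⟨0, ?_, by simp [h]⟩
      have := extremePoints_subset hP.zero_vertex
      convert this
      funext i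
      simp [toReal]
    · have hne : (Finset.univ : Finset (Fin (numVertices P))).Nonempty := by
        by_contra hne
        rw [Finset.not_nonempty_iff_eq_empty] at hne
        rw [hne] at h
        simp at h
      obtain ⟨j, -, hj⟩ := Finset.exists_mem_eq_sup _ hne fun j => (-(e u).1 j).toNat
      refine ⟨b (σ.symm (Sum.inl j)), ?_, ?_⟩
      · have : toReal (b (σ.symm (Sum.inl j))) ∈ Set.extremePoints ℝ P \ {0} := by
          rw [hJ]
          exact ⟨_, hσ j, rfl⟩
        exact extremePoints_subset this.1
      · rw [hj] at h ⊢
        rw [he] at h ⊢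
        omega

end IsUnimodularSimplex

/-! ### Dual semigroups in terms of support functions -/

section Semigroups

variable {n k : ℕ} {M : Fin k → Set (Fin n → ℝ)} {η : Fin k → (Fin n → ℤ) → ℕ}

/-- Pairing `(u, a)` with a generator `(q, e_i)` gives `u · q + a i`. The generators only involve
lattice points, so it matters that the minimum of `u` on `M i` is attained at one. -/
lemma mem_dualSemigroup_cayleyCone_iff (hη : ∀ i, IsSupport (M i) (η i)) {m : Fin n ⊕ Fin k → ℤ} :
    m ∈ dualSemigroup (cayleyCone M) ↔ ∀ i, (η i (m ∘ Sum.inl) : ℤ) ≤ m (Sum.inr i) := by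
  constructor
  · intro h i
    obtain ⟨q, hq, hq'⟩ := (hη i (m ∘ Sum.inl)).2
    have := h (Sum.elim (toReal q) (Pi.single i (1 : ℝ))) (Submodule.subset_span ⟨i, q, hq, rfl⟩)
    rw [Fintype.sum_sum_type] at this
    simp only [Sum.elim_inl, Sum.elim_inr] at this
    have h2 := sum_mul_toReal (m ∘ Sum.inl) q
    simp only [Function.comp_apply] at h2
    rw [h2] at this
    simp only [Pi.single_apply, mul_ite, mul_one, mul_zero, Finset.sum_ite_eq',
      Finset.mem_univ, if_true] at this
    norm_cast at this
    omega
  · intro h u hu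
    change u ∈ PointedCone.hull ℝ _ at hu
    induction hu using Submodule.span_induction with
    | mem x hx =>
      obtain ⟨j, q, hq, rfl⟩ := hx
      have h1 := (hη j (m ∘ Sum.inl)).1 _ hq
      have h2 : ((η j (m ∘ Sum.inl) : ℤ) : ℝ) ≤ (m (Sum.inr j) : ℝ) := by exact_mod_cast h j
      rw [Fintype.sum_sum_type]
      simp only [Function.comp_apply] at h1
      simp only [Sum.elim_inl, Sum.elim_inr, Pi.single_apply, mul_ite, mul_one, mul_zero,
        Finset.sum_ite_eq', Finset.mem_univ, if_true]
      push_cast at h2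
      linarith
    | zero => simp
    | add x y _ _ hx hy =>
      have := add_nonneg hx hy
      rw [← Finset.sum_add_distrib] at this
      simpa [mul_add] using this
    | smul a x _ hx =>
      have := mul_nonneg a.2 hx
      rw [Finset.mul_sum] at this
      refine this.trans_eq (Finset.sum_congr rfl fun i _ => ?_)
      change (a : ℝ) * _ = _ * ((a : ℝ) * x i)
      ring

/-- The minimum of a functional on a Minkowski sum is the sum of its minima on the summands. -/
lemma mem_dualSemigroup_coneOver_iff (hη : ∀ i, IsSupport (M i) (η i)) {m : Fin n ⊕ Unit → ℤ} :
    m ∈ dualSemigroup (coneOver (∑ i, M i)) ↔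
      (∑ i, η i (m ∘ Sum.inl) : ℤ) ≤ m (Sum.inr ()) := by
  have key : ∀ x : Fin k → Fin n → ℝ, ∑ i, (m (Sum.inl i) : ℝ) * (∑ j, x j) i
      = ∑ j, ∑ i, (m (Sum.inl i) : ℝ) * x j i := by
    intro x
    rw [Finset.sum_comm]
    exact Finset.sum_congr rfl fun i _ => by rw [Finset.sum_apply, Finset.mul_sum]
  constructor
  · intro h
    choose q hq hq' using fun i => (hη i (m ∘ Sum.inl)).2
    have := h ((1 : ℝ) • Sum.elim (∑ i, toReal (q i)) (fun _ => (1 : ℝ)))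
      ⟨1, zero_le_one, _, Set.mem_fintype_sum _ _ |>.2 ⟨_, hq, rfl⟩, rfl⟩
    rw [one_smul, Fintype.sum_sum_type] at this
    simp only [Sum.elim_inl, Sum.elim_inr, Finset.univ_unique, Finset.sum_singleton, mul_one] at this
    rw [key] at this
    have h3 : ∀ j, ∑ i, (m (Sum.inl i) : ℝ) * toReal (q j) i = -(η j (m ∘ Sum.inl) : ℝ) := by
      intro j
      have h2 := sum_mul_toReal (m ∘ Sum.inl) (q j)
      simp only [Function.comp_apply] at h2
      rw [h2, eq_neg_of_add_eq_zero_left (hq' j)]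
      push_cast
      rfl
    simp only [h3, Finset.sum_neg_distrib] at this
    have h4 : (∑ i, η i (m ∘ Sum.inl) : ℝ) ≤ m (Sum.inr ()) := by
      change 0 ≤ _ + (m (Sum.inr ()) : ℝ) at this
      linarith
    exact_mod_cast h4
  · rintro h _ ⟨l, hl, q, hq, rfl⟩
    obtain ⟨x, hx, rfl⟩ := (Set.mem_fintype_sum _ _).1 hq
    have h4 : (∑ i, η i (m ∘ Sum.inl) : ℝ) ≤ m (Sum.inr ()) := by exact_mod_cast h
    have h5 : ∀ j, -(η j (m ∘ Sum.inl) : ℝ) ≤ ∑ i, (m (Sum.inl i) : ℝ) * x j i := by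
      intro j
      have := (hη j (m ∘ Sum.inl)).1 _ (hx j)
      simp only [Function.comp_apply] at this
      linarith
    have h6 := Finset.sum_le_sum fun j (_ : j ∈ Finset.univ) => h5 j
    rw [← key, Finset.sum_neg_distrib] at h6
    have h7 := mul_nonneg hl (add_nonneg (sub_nonneg.2 h6) (sub_nonneg.2 h4))
    refine h7.trans_eq ?_
    rw [Fintype.sum_sum_type]
    simp only [Pi.smul_apply, Sum.elim_inl, Sum.elim_inr, smul_eq_mul, Finset.univ_unique,
      Finset.sum_singleton]
    have h8 : ∑ i, (m (Sum.inl i) : ℝ) * (l * (∑ j, x j) i)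
        = l * ∑ i, (m (Sum.inl i) : ℝ) * (∑ j, x j) i := by
      rw [Finset.mul_sum]
      exact Finset.sum_congr rfl fun i _ => by ring
    rw [h8]
    change _ = _ + (m (Sum.inr ()) : ℝ) * _
    ring

end Semigroups

/-! ### The toric ring of the Cayley cone as a module over `ℂ[t_1, …, t_k]` -/

section ToricRing

variable {n k : ℕ} {M : Fin k → Set (Fin n → ℝ)} {η : Fin k → (Fin n → ℤ) → ℕ}

lemma nonneg_of_mem_dualSemigroup (hη : ∀ i, IsSupport (M i) (η i)) {m : Fin n ⊕ Fin k → ℤ}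
    (hm : m ∈ dualSemigroup (cayleyCone M)) (i : Fin k) : 0 ≤ m (Sum.inr i) :=
  (Int.natCast_nonneg _).trans ((mem_dualSemigroup_cayleyCone_iff hη).1 hm i)

/-- The character of the lattice point `(u, a)` of the dual of the Cayley cone. -/
def chi (hη : ∀ i, IsSupport (M i) (η i)) (u : Fin n → ℤ) (a : Fin k → ℕ)
    (h : ∀ i, η i u ≤ a i) : ToricRing (cayleyCone M) :=
  AddMonoidAlgebra.single ⟨Sum.elim u (fun i => (a i : ℤ)),
    (mem_dualSemigroup_cayleyCone_iff hη).2 fun i => by simpa using h i⟩ 1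

lemma chi_induction (hη : ∀ i, IsSupport (M i) (η i)) {p : ToricRing (cayleyCone M) → Prop}
    (x : ToricRing (cayleyCone M)) (hchi : ∀ u a h, p (chi hη u a h))
    (hadd : ∀ x y, p x → p y → p (x + y)) (hsmul : ∀ (c : ℂ) x, p x → p (c • x)) : p x := by
  induction x using AddMonoidAlgebra.induction_on with
  | of m =>
    obtain ⟨m, hm⟩ := m
    have h := (mem_dualSemigroup_cayleyCone_iff hη).1 hm
    have h0 := nonneg_of_mem_dualSemigroup hη hm
    convert hchi (m ∘ Sum.inl) (fun i => (m (Sum.inr i)).toNat) fun i => by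
      have := h i
      omega
    rw [chi, AddMonoidAlgebra.of_apply]
    congr 2
    ext (i | i)
    · rfl
    · simp [h0]
  | add x y hx hy => exact hadd x y hx hy
  | smul c x hx => exact hsmul c x hx

lemma t_eq_chi (hη : ∀ i, IsSupport (M i) (η i)) (hη0 : ∀ i, η i 0 = 0) (i : Fin k) :
    t M i = chi hη 0 (Pi.single i 1) (by simp [hη0]) := by
  rw [t, chi]
  congr 2
  ext (j | j)
  · simp
  · by_cases h : j = i
    · subst h
      simp
    · simp [h]

lemma IsSupport.zero {P : Set (Fin n → ℝ)} {ν : (Fin n → ℤ) → ℕ} (h : IsSupport P ν) :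
    ν 0 = 0 := by
  obtain ⟨q, -, hq⟩ := (h 0).2
  simpa using hq

lemma chi_mul_chi (hη : ∀ i, IsSupport (M i) (η i)) (u v : Fin n → ℤ) (a b : Fin k → ℕ)
    (ha : ∀ i, η i u ≤ a i) (hb : ∀ i, η i v ≤ b i) (h : ∀ i, η i (u + v) ≤ a i + b i) :
    chi hη u a ha * chi hη v b hb = chi hη (u + v) (a + b) h := by
  rw [chi, chi, chi, AddMonoidAlgebra.single_mul_single, one_mul]
  congr 2
  ext (i | i) <;> simp

lemma prod_t_pow_mul_chi (hη : ∀ i, IsSupport (M i) (η i)) (u : Fin n → ℤ) (a b : Fin k → ℕ)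
    (ha : ∀ i, η i u ≤ a i) :
    (∏ i, t M i ^ b i) * chi hη u a ha
      = chi hη u (b + a) (fun i => (ha i).trans (Nat.le_add_left _ _)) := by
  have h1 : ∏ i, t M i ^ b i = chi hη 0 b (fun i => by simp [(hη i).zero]) := by
    rw [chi]
    simp only [t, AddMonoidAlgebra.single_pow, one_pow]
    have : ∀ s : Finset (Fin k), ∏ i ∈ s, (AddMonoidAlgebra.single (b i •
        (⟨Pi.single (Sum.inr i) 1, single_mem_dualSemigroup M i⟩ : dualSemigroup (cayleyCone M)))
        (1 : ℂ)) = AddMonoidAlgebra.single (∑ i ∈ s, b i •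
        (⟨Pi.single (Sum.inr i) 1, single_mem_dualSemigroup M i⟩ :
          dualSemigroup (cayleyCone M))) (1 : ℂ) := by
      intro s
      induction s using Finset.cons_induction with
      | empty => rfl
      | cons i s hi ih =>
        rw [Finset.prod_cons, ih, Finset.sum_cons, AddMonoidAlgebra.single_mul_single, one_mul]
    rw [this]
    congr 1
    ext j
    simp only [AddSubmonoid.coe_finsetSum, AddSubmonoidClass.coe_nsmul, Finset.sum_apply, Pi.smul_apply]
    rcases j with j | j
    · simp
    · simp [Pi.single_apply]
  rw [h1, chi_mul_chi]
  · congr 1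
    exact zero_add u
  · intro i
    rw [zero_add]
    exact (ha i).trans (Nat.le_add_left _ _)

/-- The algebra homomorphism from the toric ring of the Cayley cone sending the character of
`(u, a)` to `w u * ∏ i, τ i ^ a i`. -/
def toricHom {R : Type} [CommRing R] [Algebra ℂ R] (hη : ∀ i, IsSupport (M i) (η i))
    (w : Multiplicative (Fin n → ℤ) →* R) (τ : Fin k → R) : ToricRing (cayleyCone M) →ₐ[ℂ] R :=
  AddMonoidAlgebra.lift ℂ R _
    { toFun := fun m => w (Multiplicative.ofAdd (m.toAdd.1 ∘ Sum.inl)) *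
        ∏ i, τ i ^ (m.toAdd.1 (Sum.inr i)).toNat
      map_one' := by
        change w 1 * ∏ i, τ i ^ (0 : ℤ).toNat = 1
        simp
      map_mul' := fun a b => by
        -- `Int.toNat` is additive here because the last `k` coordinates are non-negative on the
        -- dual semigroup.
        have h : ∀ i, ((a * b).toAdd.1 (Sum.inr i)).toNat
            = (a.toAdd.1 (Sum.inr i)).toNat + (b.toAdd.1 (Sum.inr i)).toNat := fun i =>
          Int.toNat_add (nonneg_of_mem_dualSemigroup hη a.toAdd.2 i)
            (nonneg_of_mem_dualSemigroup hη b.toAdd.2 i)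
        have h' : w (Multiplicative.ofAdd ((a * b).toAdd.1 ∘ Sum.inl))
            = w (Multiplicative.ofAdd (a.toAdd.1 ∘ Sum.inl)) *
              w (Multiplicative.ofAdd (b.toAdd.1 ∘ Sum.inl)) := by
          rw [← map_mul]
          rfl
        simp only [h, h', pow_add, Finset.prod_mul_distrib]
        ring }

lemma toricHom_chi {R : Type} [CommRing R] [Algebra ℂ R] (hη : ∀ i, IsSupport (M i) (η i))
    (w : Multiplicative (Fin n → ℤ) →* R) (τ : Fin k → R) (u a h) :
    toricHom hη w τ (chi hη u a h) = w (Multiplicative.ofAdd u) * ∏ i, τ i ^ a i := by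
  rw [toricHom, chi, AddMonoidAlgebra.lift_single, one_smul]
  rfl

lemma toricHom_t {R : Type} [CommRing R] [Algebra ℂ R] (hη : ∀ i, IsSupport (M i) (η i))
    (w : Multiplicative (Fin n → ℤ) →* R) (τ : Fin k → R) (i : Fin k) :
    toricHom hη w τ (t M i) = τ i := by
  rw [t_eq_chi hη (fun i => (hη i).zero), toricHom_chi, ofAdd_zero, map_one, one_mul,
    Finset.prod_eq_single i]
  · simp
  · intro j _ hj
    simp [hj]
  · simp

lemma toricRing_algHom_ext {R : Type} [CommRing R] [Algebra ℂ R]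
    (hη : ∀ i, IsSupport (M i) (η i)) {f g : ToricRing (cayleyCone M) →ₐ[ℂ] R}
    (h : ∀ u a ha, f (chi hη u a ha) = g (chi hη u a ha)) : f = g := by
  refine AlgHom.ext fun x => ?_
  induction x using chi_induction hη with
  | hchi u a ha => exact h u a ha
  | hadd x y hx hy => rw [map_add, map_add, hx, hy]
  | hsmul c x hx => rw [map_smul, map_smul, hx]

/-- The toric ring embeds into Laurent polynomials over any domain in which the `t_i` are given
non-zero values. -/
def laurentHom {R : Type} [CommRing R] [Algebra ℂ R] (hη : ∀ i, IsSupport (M i) (η i))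
    (τ : Fin k → R) : ToricRing (cayleyCone M) →ₐ[ℂ] AddMonoidAlgebra R (Fin n → ℤ) :=
  toricHom hη (AddMonoidAlgebra.of R (Fin n → ℤ)) (fun i => algebraMap R _ (τ i))

/-- The character `(u, a)` is `∏ t_i ^ (a i - η i u)` times the minimal character `(u, η(u))`; this
is the spanning half of freeness. -/
lemma exists_eq_sum (hη : ∀ i, IsSupport (M i) (η i)) (x : ToricRing (cayleyCone M)) :
    ∃ c : (Fin n → ℤ) →₀ MvPolynomial (Fin k) ℂ,
      x = c.sum fun u p => MvPolynomial.aeval (t M) p * chi hη u (fun i => η i u)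
        (fun _ => le_rfl) := by
  induction x using chi_induction hη with
  | hchi u a h =>
    refine ⟨Finsupp.single u (∏ i, MvPolynomial.X i ^ (a i - η i u)), ?_⟩
    rw [Finsupp.sum_single_index (by simp), map_prod]
    simp only [map_pow, MvPolynomial.aeval_X]
    rw [prod_t_pow_mul_chi]
    congr 1
    funext i
    exact (Nat.sub_add_cancel (h i)).symm
  | hadd x y hx hy =>
    obtain ⟨c, rfl⟩ := hx
    obtain ⟨d, rfl⟩ := hy
    refine ⟨c + d, ?_⟩
    rw [Finsupp.sum_add_index' (by simp) (by simp [add_mul])]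
  | hsmul r x hx =>
    obtain ⟨c, rfl⟩ := hx
    refine ⟨r • c, ?_⟩
    rw [Finsupp.sum_smul_index' (by simp), Finsupp.smul_sum]
    simp only [map_smul, smul_mul_assoc]

/-- Distinct `u` land in distinct Laurent degrees, so each coefficient can be recovered up to a
product of powers of the `τ i`. This gives linear independence, and later the kernel over the line.
-/
lemma laurentHom_sum {R : Type} [CommRing R] [Algebra ℂ R] (hη : ∀ i, IsSupport (M i) (η i))
    (τ : Fin k → R) (c : (Fin n → ℤ) →₀ MvPolynomial (Fin k) ℂ) (v : Fin n → ℤ) :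
    (laurentHom hη τ (c.sum fun u p => MvPolynomial.aeval (t M) p *
      chi hη u (fun i => η i u) (fun _ => le_rfl))).coeff v
      = MvPolynomial.aeval τ (c v) * ∏ i, τ i ^ η i v := by
  have h1 : ∀ p : MvPolynomial (Fin k) ℂ, laurentHom hη τ (MvPolynomial.aeval (t M) p)
      = algebraMap R _ (MvPolynomial.aeval τ p) := by
    intro p
    have : (laurentHom hη τ).comp (MvPolynomial.aeval (t M))
        = (IsScalarTower.toAlgHom ℂ R (AddMonoidAlgebra R (Fin n → ℤ))).comp
          (MvPolynomial.aeval τ) := by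
      ext i
      simp [laurentHom, toricHom_t]
    exact DFunLike.congr_fun this p
  have h2 : ∀ u, laurentHom hη τ (chi hη u (fun i => η i u) (fun _ => le_rfl))
      = AddMonoidAlgebra.single u (∏ i, τ i ^ η i u) := by
    intro u
    rw [laurentHom, toricHom_chi]
    simp only [← map_pow, ← map_prod]
    rw [mul_comm, ← Algebra.smul_def, AddMonoidAlgebra.of_apply]
    simp
  rw [Finsupp.sum, map_sum, AddMonoidAlgebra.coeff_sum, Finsupp.finsetSum_apply]
  simp only [map_mul, h1, h2, ← Algebra.smul_def, AddMonoidAlgebra.smul_single, smul_eq_mul,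
    AddMonoidAlgebra.coeff_single]
  rw [Finset.sum_eq_single v]
  · simp
  · intro u _ hu
    simp [hu]
  · intro hv
    simp [Finsupp.notMem_support_iff.1 hv]

/-- The toric ring is free over the polynomial ring in the `t_i`. -/
lemma flat_aeval_t (hη : ∀ i, IsSupport (M i) (η i)) :
    (MvPolynomial.aeval (R := ℂ) (t M)).toRingHom.Flat := by
  algebraize [(MvPolynomial.aeval (R := ℂ) (t M)).toRingHom]
  have hsmul : ∀ (p : MvPolynomial (Fin k) ℂ) (x : ToricRing (cayleyCone M)),
      p • x = MvPolynomial.aeval (t M) p * x := fun p x => rfl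
  let f := Finsupp.linearCombination (MvPolynomial (Fin k) ℂ)
    (fun u => chi hη u (fun i => η i u) (fun _ => le_rfl))
  have hf : Function.Bijective f := by
    constructor
    · rw [injective_iff_map_eq_zero]
      intro c hc
      ext1 u
      -- With `τ = X` the evaluation of the coefficients is the identity.
      have := laurentHom_sum hη (MvPolynomial.X (R := ℂ)) c u
      rw [Finsupp.linearCombination_apply] at hc
      simp only [hsmul] at hc
      rw [hc, map_zero, MvPolynomial.aeval_X_left_apply] at this
      refine (mul_eq_zero.1 this.symm).resolve_right ?_
      exact Finset.prod_ne_zero_iff.2 fun i _ => pow_ne_zero _ (MvPolynomial.X_ne_zero i)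
    · intro x
      obtain ⟨c, rfl⟩ := exists_eq_sum hη x
      exact ⟨c, by rw [Finsupp.linearCombination_apply]; rfl⟩
  exact Module.Flat.of_linearEquiv (LinearEquiv.ofBijective f hf).symm

end ToricRing

/-! ### Flatness, and the equations of the deformation -/

lemma flat_rename_subtype {k : ℕ} (p : Fin k → Prop) [DecidablePred p] :
    (MvPolynomial.rename (R := ℂ) (Subtype.val : {i // p i} → Fin k)).toRingHom.Flat := by
  let σ : {i // ¬ p i} ⊕ {i // p i} ≃ Fin k := (Equiv.sumComm _ _).trans (Equiv.sumCompl p)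
  let e := (MvPolynomial.sumAlgEquiv ℂ {i // ¬ p i} {i // p i}).symm.trans
    (MvPolynomial.renameEquiv ℂ σ)
  have h : (MvPolynomial.rename (R := ℂ) (Subtype.val : {i // p i} → Fin k)).toRingHom
      = e.toAlgHom.toRingHom.comp (algebraMap (MvPolynomial {i // p i} ℂ) _) := by
    apply MvPolynomial.ringHom_ext
    · intro r
      have : e (MvPolynomial.C (MvPolynomial.C r)) = MvPolynomial.C r :=
        e.commutes r
      simpa using this.symm
    · intro i
      have : (MvPolynomial.sumAlgEquiv ℂ {i // ¬ p i} {i // p i}).symm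
          (MvPolynomial.C (MvPolynomial.X i)) = MvPolynomial.X (Sum.inr i) := by
        rw [AlgEquiv.symm_apply_eq]
        exact (MvPolynomial.sumRingEquiv_X_inr ℂ _ _ i).symm
      simp [e, this, σ]
  rw [h]
  exact RingHom.Flat.comp (RingHom.flat_algebraMap_iff.2 inferInstance)
    (RingHom.Flat.of_bijective e.bijective)

/-- The substitution `X_0 ↦ X_0`, `X_i ↦ X_0 - X_i` is an involution, so up to an automorphism the
map is the inclusion of a polynomial subring. -/
lemma flat_aeval_X_sub_X {k : ℕ} [NeZero k] :
    (MvPolynomial.aeval (R := ℂ) (fun i : {i : Fin k // i ≠ 0} =>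
      (MvPolynomial.X 0 - MvPolynomial.X i.1 : MvPolynomial (Fin k) ℂ))).toRingHom.Flat := by
  let α : MvPolynomial (Fin k) ℂ →ₐ[ℂ] MvPolynomial (Fin k) ℂ := MvPolynomial.aeval fun i =>
    if i = 0 then MvPolynomial.X 0 else MvPolynomial.X 0 - MvPolynomial.X i
  have hα : α.comp α = AlgHom.id _ _ := by
    ext1 i
    by_cases h : i = 0
    · simp [α, h]
    · simp [α, h]
  have hα' : Function.Involutive α := fun x => DFunLike.congr_fun hα x
  have h : MvPolynomial.aeval (R := ℂ) (fun i : {i : Fin k // i ≠ 0} =>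
      (MvPolynomial.X 0 - MvPolynomial.X i.1 : MvPolynomial (Fin k) ℂ))
      = α.comp (MvPolynomial.rename Subtype.val) := by
    ext1 i
    simp [α, i.2]
  rw [h]
  exact RingHom.Flat.comp (flat_rename_subtype _) (RingHom.Flat.of_bijective hα'.bijective)

section Deformation

variable {n k : ℕ} [NeZero k] {M : Fin k → Set (Fin n → ℝ)} {η : Fin k → (Fin n → ℤ) → ℕ}

lemma flat_Psi (hη : ∀ i, IsSupport (M i) (η i)) : Flat (Psi M) := by
  have h : MvPolynomial.aeval (R := ℂ) (fun i : {i : Fin k // i ≠ 0} => t M 0 - t M i.1)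
      = (MvPolynomial.aeval (t M)).comp (MvPolynomial.aeval (R := ℂ)
        (fun i : {i : Fin k // i ≠ 0} =>
        (MvPolynomial.X 0 - MvPolynomial.X i.1 : MvPolynomial (Fin k) ℂ))) := by
    ext1 i
    simp
  refine Flat.SpecMap_iff.2 ?_
  rw [CommRingCat.hom_ofHom, h]
  exact RingHom.Flat.comp flat_aeval_X_sub_X (flat_aeval_t hη)

/-- The ideal of the fibre of `Ψ` over `ε`. -/
def deformationIdeal (M : Fin k → Set (Fin n → ℝ)) (ε : Fin k → ℂ) :
    Ideal (ToricRing (cayleyCone M)) :=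
  Ideal.span (Set.range fun i : {i : Fin k // i ≠ 0} =>
    t M 0 - t M i.1 - algebraMap ℂ _ (ε i.1))

/-- The coordinate ring of the deformation. -/
abbrev DeformationRing (M : Fin k → Set (Fin n → ℝ)) (ε : Fin k → ℂ) : Type :=
  ToricRing (cayleyCone M) ⧸ deformationIdeal M ε

/-- The function `t_1 - ε_i` on the line. -/
def lineCoord (ε : Fin k → ℂ) (i : Fin k) : MvPolynomial Unit ℂ :=
  MvPolynomial.X () - MvPolynomial.C (ε i)

lemma deformationIdeal_le_ker {R : Type} [CommRing R] [Algebra ℂ R] {ε : Fin k → ℂ}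
    (φ : ToricRing (cayleyCone M) →ₐ[ℂ] R)
    (h : ∀ i, φ (t M 0) - φ (t M i) = algebraMap ℂ R (ε i)) :
    ∀ x ∈ deformationIdeal M ε, φ x = 0 := by
  intro x hx
  have : deformationIdeal M ε ≤ RingHom.ker φ := by
    rw [deformationIdeal, Ideal.span_le]
    rintro _ ⟨i, rfl⟩
    change φ _ = 0
    rw [map_sub, map_sub, h, AlgHom.commutes, sub_self]
  exact this hx

/-- Modulo the ideal each `t_i` equals `t M 0 - ε i`, so an element is determined by its
coefficients restricted to the line, and the Laurent expansion detects these. Distinctness of the `ε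
i` plays no part, so `ε = 0` is covered too. -/
lemma mem_deformationIdeal_iff (hη : ∀ i, IsSupport (M i) (η i)) {ε : Fin k → ℂ} (hε : ε 0 = 0)
    (x : ToricRing (cayleyCone M)) :
    x ∈ deformationIdeal M ε ↔ laurentHom hη (lineCoord ε) x = 0 := by
  constructor
  · refine deformationIdeal_le_ker _ (fun i => ?_) x
    simp only [laurentHom, toricHom_t]
    rw [← map_sub, lineCoord, lineCoord, hε, IsScalarTower.algebraMap_apply ℂ (MvPolynomial Unit ℂ)]
    congr 1
    simp [MvPolynomial.algebraMap_eq]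
  · intro hx
    obtain ⟨c, rfl⟩ := exists_eq_sum hη x
    have hc : ∀ u, MvPolynomial.aeval (lineCoord ε) (c u) = 0 := by
      intro u
      have := laurentHom_sum hη (lineCoord ε) c u
      rw [hx] at this
      refine (mul_eq_zero.1 this.symm).resolve_right ?_
      refine Finset.prod_ne_zero_iff.2 fun i _ => pow_ne_zero _ fun h => ?_
      -- At the point `ε i + 1` the function `t - ε i` takes the value `1`.
      have h1 := congrArg (MvPolynomial.eval fun _ => ε i + 1) h
      simp [lineCoord] at h1
    have key : ∀ p : MvPolynomial (Fin k) ℂ, Ideal.Quotient.mkₐ ℂ (deformationIdeal M ε)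
        (MvPolynomial.aeval (t M) p) = MvPolynomial.aeval (R := ℂ)
          (fun _ : Unit => Ideal.Quotient.mkₐ ℂ (deformationIdeal M ε) (t M 0))
          (MvPolynomial.aeval (lineCoord ε) p) := by
      intro p
      have : (Ideal.Quotient.mkₐ ℂ (deformationIdeal M ε)).comp (MvPolynomial.aeval (t M))
          = (MvPolynomial.aeval (R := ℂ)
          (fun _ : Unit => Ideal.Quotient.mkₐ ℂ (deformationIdeal M ε) (t M 0))).comp
          (MvPolynomial.aeval (lineCoord ε)) := by
        ext1 i
        simp only [AlgHom.comp_apply, MvPolynomial.aeval_X, lineCoord, map_sub,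
          MvPolynomial.algHom_C]
        by_cases hi : i = 0
        · subst hi
          rw [hε, map_zero, sub_zero]
        · rw [eq_sub_iff_add_eq, ← sub_eq_zero, ← (Ideal.Quotient.mkₐ ℂ _).commutes,
            ← map_add, ← map_sub]
          have h : t M i + algebraMap ℂ _ (ε i) - t M 0
              = -(t M 0 - t M i - algebraMap ℂ _ (ε i)) := by ring
          rw [h, map_neg, neg_eq_zero]
          exact Ideal.Quotient.eq_zero_iff_mem.2 (Ideal.subset_span ⟨⟨i, hi⟩, rfl⟩)
      exact DFunLike.congr_fun this p
    rw [← Ideal.Quotient.eq_zero_iff_mem, ← Ideal.Quotient.mkₐ_eq_mk ℂ, Finsupp.sum, map_sum]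
    refine Finset.sum_eq_zero fun u _ => ?_
    rw [map_mul, key, hc, map_zero, zero_mul]

/-- A homomorphism `φ` through which the embedding in the Laurent polynomial ring factors, and whose
image contains every element up to powers of `φ g`, becomes an isomorphism when `g` is inverted. -/
lemma isLocalization_away_deformationRing (hη : ∀ i, IsSupport (M i) (η i)) {ε : Fin k → ℂ} (hε : ε 0 = 0)
    {B : Type} [CommRing B] [Algebra ℂ B] (φ : ToricRing (cayleyCone M) →ₐ[ℂ] B)
    (hφ : ∀ i, φ (t M 0) - φ (t M i) = algebraMap ℂ B (ε i))
    (β : B →ₐ[ℂ] AddMonoidAlgebra (MvPolynomial Unit ℂ) (Fin n → ℤ))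
    (hβ : β.comp φ = laurentHom hη (lineCoord ε)) (g : ToricRing (cayleyCone M))
    (hg : ∀ b : B, ∃ (N : ℕ) (a : ToricRing (cayleyCone M)), φ g ^ N * b = φ a)
    (L : Type) [CommRing L] [Algebra B L] [IsLocalization.Away (φ g) L] :
    @IsLocalization.Away _ _ (Ideal.Quotient.mk (deformationIdeal M ε) g) L _
      ((algebraMap B L).comp
        (Ideal.Quotient.lift (deformationIdeal M ε) (φ : _ →+* B)
          (deformationIdeal_le_ker φ hφ))).toAlgebra := by
  let := ((algebraMap B L).comp (Ideal.Quotient.lift (deformationIdeal M ε) (φ : _ →+* B)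
          (deformationIdeal_le_ker φ hφ))).toAlgebra
  have hmk : ∀ a, algebraMap (DeformationRing M ε) L (Ideal.Quotient.mk _ a)
      = algebraMap B L (φ a) := fun a => rfl
  -- The composite `β ∘ φ` already has the deformation ideal as its kernel, so `φ` kills nothing
  -- more.
  have hinj : ∀ a, φ a = 0 → a ∈ deformationIdeal M ε := by
    intro a ha
    rw [mem_deformationIdeal_iff hη hε, ← hβ, AlgHom.comp_apply, ha, map_zero]
  refine isLocalization_iff _ _ |>.2 ⟨?_, ?_, ?_⟩
  · rintro ⟨_, N, rfl⟩
    simp only [map_pow, hmk]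
    exact (IsLocalization.Away.algebraMap_isUnit (φ g)).pow N
  · intro z
    obtain ⟨N, b, hb⟩ := IsLocalization.Away.surj (φ g) z
    obtain ⟨N', a, ha⟩ := hg b
    refine ⟨⟨Ideal.Quotient.mk _ a, ⟨_, N + N', rfl⟩⟩, ?_⟩
    simp only [map_pow, hmk]
    rw [← ha, pow_add, ← mul_assoc, hb, map_mul, map_pow, mul_comm]
  · intro x y hxy
    obtain ⟨x, rfl⟩ := Ideal.Quotient.mk_surjective x
    obtain ⟨y, rfl⟩ := Ideal.Quotient.mk_surjective y
    rw [hmk, hmk] at hxy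
    obtain ⟨N, hN⟩ := IsLocalization.Away.exists_of_eq (φ g) hxy
    refine ⟨⟨_, N, rfl⟩, ?_⟩
    simp only [← map_pow, ← map_mul]
    rw [Ideal.Quotient.eq]
    apply hinj
    rw [map_sub, map_mul, map_mul, map_pow, hN, sub_self]

end Deformation

/-! ### The central fibre -/

section Central

variable {n k : ℕ} [NeZero k] {M : Fin k → Set (Fin n → ℝ)} {η : Fin k → (Fin n → ℤ) → ℕ}

/-- The homomorphism of semigroups `(u, a) ↦ (u, ∑ i, a i)`. -/
def sumHom (hη : ∀ i, IsSupport (M i) (η i)) :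
    dualSemigroup (cayleyCone M) →+ dualSemigroup (coneOver (∑ i, M i)) where
  toFun m := ⟨Sum.elim (m.1 ∘ Sum.inl) (fun _ => ∑ i, m.1 (Sum.inr i)), by
    rw [mem_dualSemigroup_coneOver_iff hη]
    exact Finset.sum_le_sum fun i _ => (mem_dualSemigroup_cayleyCone_iff hη).1 m.2 i⟩
  map_zero' := by
    ext (i | i) <;> simp
  map_add' a b := by
    ext (i | i) <;> simp [Finset.sum_add_distrib]

/-- The homomorphism of toric rings given by the inclusion of the cone over `Q`. -/
def centralHom (hη : ∀ i, IsSupport (M i) (η i)) :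
    ToricRing (cayleyCone M) →ₐ[ℂ] ToricRing (coneOver (∑ i, M i)) :=
  AddMonoidAlgebra.mapDomainAlgHom ℂ ℂ (sumHom hη)

lemma centralHom_surjective (hη : ∀ i, IsSupport (M i) (η i)) :
    Function.Surjective (centralHom hη) := by
  have key : Function.Surjective (sumHom hη) := ?_
  · intro y
    induction y using AddMonoidAlgebra.induction_on with
    | of m =>
      obtain ⟨m, rfl⟩ := key m
      exact ⟨AddMonoidAlgebra.single m 1, AddMonoidAlgebra.mapDomain_single⟩
    | add x y hx hy =>
      obtain ⟨x, rfl⟩ := hx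
      obtain ⟨y, rfl⟩ := hy
      exact ⟨x + y, map_add _ _ _⟩
    | smul c x hx =>
      obtain ⟨x, rfl⟩ := hx
      exact ⟨c • x, map_smul _ _ _⟩
  rintro ⟨m, hm⟩
  have h := (mem_dualSemigroup_coneOver_iff hη).1 hm
  -- Each `a i` is taken minimal, and the surplus of the height over `∑ η i` is assigned to the
  -- index `0`.
  refine ⟨⟨Sum.elim (m ∘ Sum.inl) (fun i => η i (m ∘ Sum.inl) +
    if i = 0 then m (Sum.inr ()) - ∑ i, (η i (m ∘ Sum.inl) : ℤ) else 0), ?_⟩, ?_⟩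
  · rw [mem_dualSemigroup_cayleyCone_iff hη]
    intro i
    simp only [Sum.elim_comp_inl, Sum.elim_inr]
    split_ifs <;> omega
  · ext (i | i)
    · rfl
    · simp [sumHom, Finset.sum_add_distrib]

/-- For `ε = 0` the Laurent expansion depends on `a` only through `∑ a i`, so it factors through
`centralHom` via `γ`. -/
lemma ker_centralHom (hη : ∀ i, IsSupport (M i) (η i)) (x : ToricRing (cayleyCone M)) :
    centralHom hη x = 0 ↔ x ∈ deformationIdeal M 0 := by
  constructor
  · intro hx
    rw [mem_deformationIdeal_iff hη rfl]
    have h0 : ∀ m : dualSemigroup (coneOver (∑ i, M i)), 0 ≤ m.1 (Sum.inr ()) := fun m =>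
      (Finset.sum_nonneg fun i _ => Int.natCast_nonneg _).trans
        ((mem_dualSemigroup_coneOver_iff hη).1 m.2)
    let w := AddMonoidAlgebra.of (MvPolynomial Unit ℂ) (Fin n → ℤ)
    let γ : ToricRing (coneOver (∑ i, M i)) →ₐ[ℂ]
        AddMonoidAlgebra (MvPolynomial Unit ℂ) (Fin n → ℤ) :=
      AddMonoidAlgebra.lift ℂ _ _
        { toFun := fun m => w (Multiplicative.ofAdd (m.toAdd.1 ∘ Sum.inl)) *
            algebraMap (MvPolynomial Unit ℂ) _ (MvPolynomial.X ()) ^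
              (m.toAdd.1 (Sum.inr ())).toNat
          map_one' := by
            change w 1 * _ ^ (0 : ℤ).toNat = 1
            simp
          map_mul' := fun a b => by
            have h : ((a * b).toAdd.1 (Sum.inr ())).toNat
                = (a.toAdd.1 (Sum.inr ())).toNat + (b.toAdd.1 (Sum.inr ())).toNat :=
              Int.toNat_add (h0 a.toAdd) (h0 b.toAdd)
            have h' : w (Multiplicative.ofAdd ((a * b).toAdd.1 ∘ Sum.inl))
                = w (Multiplicative.ofAdd (a.toAdd.1 ∘ Sum.inl)) *
                  w (Multiplicative.ofAdd (b.toAdd.1 ∘ Sum.inl)) := by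
              rw [← map_mul]
              rfl
            rw [h, h', pow_add]
            ring }
    have h : γ.comp (centralHom hη) = laurentHom hη (lineCoord 0) := by
      refine toricRing_algHom_ext hη fun u a ha => ?_
      rw [AlgHom.comp_apply, laurentHom, toricHom_chi, centralHom, chi,
        AddMonoidAlgebra.mapDomainAlgHom_apply, AddMonoidAlgebra.mapDomain_single,
        AddMonoidAlgebra.lift_single, one_smul]
      have h1 : (∑ i, (a i : ℤ)).toNat = ∑ i, a i := by
        rw [← Nat.cast_sum, Int.toNat_natCast]
      change w (Multiplicative.ofAdd u) * _ ^ (∑ i, (a i : ℤ)).toNat = _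
      have h2 : ∀ i : Fin k, lineCoord 0 i = MvPolynomial.X () := fun i => by simp [lineCoord]
      simp only [h1, h2, Finset.prod_pow_eq_pow_sum]
      rfl
    rw [← h, AlgHom.comp_apply, hx, map_zero]
  · refine deformationIdeal_le_ker _ (fun i => ?_) x
    have h : ∀ i, centralHom hη (t M i) = centralHom hη (t M 0) := by
      intro i
      simp only [centralHom, t, AddMonoidAlgebra.mapDomainAlgHom_apply,
        AddMonoidAlgebra.mapDomain_single]
      congr 1
      ext (j | j) <;> simp [sumHom, Pi.single_apply]
    rw [h i, sub_self, Pi.zero_apply, map_zero]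

end Central

/-! ### Charts of the deformation -/

section Charts

variable {n k : ℕ} {M : Fin k → Set (Fin n → ℝ)} {η : Fin k → (Fin n → ℤ) → ℕ}

lemma exists_pow_mul_eq_add {A B : Type} [CommRing A] [CommRing B] [Algebra ℂ A] [Algebra ℂ B]
    (φ : A →ₐ[ℂ] B) (g : A) {x y : B} (hx : ∃ (N : ℕ) (a : A), φ g ^ N * x = φ a)
    (hy : ∃ (N : ℕ) (a : A), φ g ^ N * y = φ a) :
    ∃ (N : ℕ) (a : A), φ g ^ N * (x + y) = φ a := by
  obtain ⟨N, a, ha⟩ := hx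
  obtain ⟨N', a', ha'⟩ := hy
  refine ⟨N + N', g ^ N' * a + g ^ N * a', ?_⟩
  rw [map_add, map_mul, map_mul, map_pow, map_pow, ← ha, ← ha']
  ring

lemma mvPolynomial_torusRing_induction {J : Type} {r : ℕ}
    {p : MvPolynomial J (TorusRing r) → Prop} (x : MvPolynomial J (TorusRing r))
    (hmon : ∀ s c, p (MvPolynomial.monomial s (AddMonoidAlgebra.single c 1)))
    (hadd : ∀ x y, p x → p y → p (x + y)) (hsmul : ∀ (c : ℂ) x, p x → p (c • x)) : p x := by
  induction x using MvPolynomial.induction_on' with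
  | monomial s a =>
    induction a using AddMonoidAlgebra.induction_on with
    | of c => exact hmon s c
    | add x y hx hy =>
      rw [map_add]
      exact hadd _ _ hx hy
    | smul c x hx =>
      rw [← MvPolynomial.smul_monomial]
      exact hsmul _ _ hx
  | add x y hx hy => exact hadd _ _ hx hy

/-- The value of `t_j` on the chart around the fibre over `ε i`. -/
def modelCoord (m r : ℕ) (ε : Fin k → ℂ) (i j : Fin k) : ModelRing m r :=
  algebraMap ℂ _ (ε i - ε j) + coordProd m r

lemma nonneg_add_coord (hη : ∀ i, IsSupport (M i) (η i)) {m r : ℕ} {i : Fin k}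
    {e : (Fin n → ℤ) ≃+ (Fin m → ℤ) × (Fin r → ℤ)}
    (he : ∀ u, η i u = Finset.univ.sup fun j => (-(e u).1 j).toNat)
    (p : dualSemigroup (cayleyCone M)) (j : Fin m) :
    0 ≤ p.1 (Sum.inr i) + (e (p.1 ∘ Sum.inl)).1 j := by
  have h := (mem_dualSemigroup_cayleyCone_iff hη).1 p.2 i
  have h1 : (-(e (p.1 ∘ Sum.inl)).1 j).toNat ≤ η i (p.1 ∘ Sum.inl) := by
    rw [he]
    exact Finset.le_sup (f := fun j => (-(e (p.1 ∘ Sum.inl)).1 j).toNat) (Finset.mem_univ j)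
  omega

/-- The chart around the fibre over `ε i`. -/
def modelHom (hη : ∀ i, IsSupport (M i) (η i)) (ε : Fin k → ℂ) {m r : ℕ} {i : Fin k}
    (e : (Fin n → ℤ) ≃+ (Fin m → ℤ) × (Fin r → ℤ))
    (he : ∀ u, η i u = Finset.univ.sup fun j => (-(e u).1 j).toNat) :
    ToricRing (cayleyCone M) →ₐ[ℂ] ModelRing m r :=
  AddMonoidAlgebra.lift ℂ _ _
    -- With `e u = (v, c)`, the exponents are `a i` for `x_0` and `a i + v_j` for `x_j`, both
    -- non-negative; `c` is the torus character. The remaining `t_j` are functions of `x_0 ⋯ x_m`.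
    { toFun := fun p => MvPolynomial.C (AddMonoidAlgebra.single (e (p.toAdd.1 ∘ Sum.inl)).2 1) *
        MvPolynomial.X 0 ^ (p.toAdd.1 (Sum.inr i)).toNat *
        (∏ j, MvPolynomial.X (Fin.succ j) ^
          (p.toAdd.1 (Sum.inr i) + (e (p.toAdd.1 ∘ Sum.inl)).1 j).toNat) *
        ∏ j ∈ Finset.univ.erase i, modelCoord m r ε i j ^ (p.toAdd.1 (Sum.inr j)).toNat
      map_one' := by
        have h : (e ((1 : Multiplicative (dualSemigroup (cayleyCone M))).toAdd.1 ∘ Sum.inl)) = 0 :=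
          map_zero e
        have h' : ∀ j, (1 : Multiplicative (dualSemigroup (cayleyCone M))).toAdd.1 (Sum.inr j) = 0 :=
          fun _ => rfl
        simp only [h, h']
        simp [← AddMonoidAlgebra.one_def]
      map_mul' := fun p q => by
        have h : ∀ j, ((p * q).toAdd.1 (Sum.inr j)).toNat
            = (p.toAdd.1 (Sum.inr j)).toNat + (q.toAdd.1 (Sum.inr j)).toNat := fun j =>
          Int.toNat_add (nonneg_of_mem_dualSemigroup hη p.toAdd.2 j)
            (nonneg_of_mem_dualSemigroup hη q.toAdd.2 j)
        have h1 : e ((p * q).toAdd.1 ∘ Sum.inl)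
            = e (p.toAdd.1 ∘ Sum.inl) + e (q.toAdd.1 ∘ Sum.inl) := map_add e _ _
        have h2 : ∀ j, ((p * q).toAdd.1 (Sum.inr i) + (e ((p * q).toAdd.1 ∘ Sum.inl)).1 j).toNat
            = (p.toAdd.1 (Sum.inr i) + (e (p.toAdd.1 ∘ Sum.inl)).1 j).toNat +
              (q.toAdd.1 (Sum.inr i) + (e (q.toAdd.1 ∘ Sum.inl)).1 j).toNat := by
          intro j
          rw [← Int.toNat_add (nonneg_add_coord hη he _ j) (nonneg_add_coord hη he _ j), h1]
          change (_ + _ + (_ + _) : ℤ).toNat = _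
          congr 1
          ring
        have h3 : AddMonoidAlgebra.single (e ((p * q).toAdd.1 ∘ Sum.inl)).2 (1 : ℂ)
            = AddMonoidAlgebra.single (e (p.toAdd.1 ∘ Sum.inl)).2 1 *
              AddMonoidAlgebra.single (e (q.toAdd.1 ∘ Sum.inl)).2 1 := by
          rw [AddMonoidAlgebra.single_mul_single, one_mul, h1]
          rfl
        simp only [h, h2, h3, pow_add, Finset.prod_mul_distrib, map_mul]
        ring }

lemma coordProd_eq (m r : ℕ) :
    coordProd m r = MvPolynomial.X 0 * ∏ j : Fin m, MvPolynomial.X j.succ :=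
  Fin.prod_univ_succ _

/-! ### The chart around a special fibre -/

section Model

variable (hη : ∀ i, IsSupport (M i) (η i)) (ε : Fin k → ℂ) {m r : ℕ} {i : Fin k}
    (e : (Fin n → ℤ) ≃+ (Fin m → ℤ) × (Fin r → ℤ))
    (he : ∀ u, η i u = Finset.univ.sup fun j => (-(e u).1 j).toNat)

lemma modelHom_chi (u a h) :
    modelHom hη ε e he (chi hη u a h)
      = MvPolynomial.C (AddMonoidAlgebra.single (e u).2 1) * MvPolynomial.X 0 ^ a i *
        (∏ j, MvPolynomial.X (Fin.succ j) ^ (a i + (e u).1 j).toNat) *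
        ∏ j ∈ Finset.univ.erase i, modelCoord m r ε i j ^ a j := by
  rw [modelHom, chi, AddMonoidAlgebra.lift_single, one_smul]
  rfl

lemma modelHom_t (j : Fin k) : modelHom hη ε e he (t M j) = modelCoord m r ε i j := by
  rw [t_eq_chi hη (fun i => (hη i).zero), modelHom_chi, map_zero]
  by_cases h : j = i
  · subst h
    rw [Finset.prod_eq_one (s := Finset.univ.erase j) fun l hl => by
      simp [Finset.ne_of_mem_erase hl]]
    simp [modelCoord, coordProd_eq, ← AddMonoidAlgebra.one_def]
  · rw [Finset.prod_eq_single j (fun l _ hl => by simp [hl]) (fun hj => by simp [h] at hj)]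
    simp [Ne.symm h, ← AddMonoidAlgebra.one_def]

/-- Here `x_0` has degree `(-1, …, -1)` and `x_j` the `j`-th unit vector, so the contributions of
`N` cancel. -/
lemma monomial_prod_aux {E : Type} [CommRing E]
    (W : Multiplicative ((Fin m → ℤ) × (Fin r → ℤ)) →* E) (v : Fin m → ℤ) (c : Fin r → ℤ) (N : ℕ)
    (h : ∀ j, 0 ≤ N + v j) :
    W (Multiplicative.ofAdd (0, c)) * W (Multiplicative.ofAdd (-1, 0)) ^ N *
      ∏ j, W (Multiplicative.ofAdd (Pi.single j 1, 0)) ^ (N + v j).toNat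
      = W (Multiplicative.ofAdd (v, c)) := by
  simp only [← map_pow, ← map_prod, ← map_mul, ← ofAdd_nsmul, ← ofAdd_sum, ← ofAdd_add]
  congr 2
  ext l
  · simp [Prod.fst_sum, Finset.sum_apply, Pi.single_apply, h]
  · simp [Prod.snd_sum]

/-- The Laurent expansion of the functions on the chart around the fibre over `ε i`. -/
def modelLaurent (i : Fin k) :
    ModelRing m r →ₐ[ℂ] AddMonoidAlgebra (MvPolynomial Unit ℂ) (Fin n → ℤ) :=
  MvPolynomial.aevalTower
    (AddMonoidAlgebra.lift ℂ _ _
      { toFun := fun c => AddMonoidAlgebra.single (e.symm (0, c.toAdd)) 1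
        map_one' := by
          change AddMonoidAlgebra.single (e.symm 0) 1 = 1
          rw [map_zero]
          rfl
        map_mul' := fun c d => by
          rw [AddMonoidAlgebra.single_mul_single, one_mul, ← map_add, Prod.mk_add_mk, add_zero]
          rfl })
    -- The factor `t - ε i` is placed in `x_0`, so that `x_0 ⋯ x_m` expands to `t - ε i`.
    (Fin.cases (algebraMap _ _ (lineCoord ε i) * AddMonoidAlgebra.single (e.symm (-1, 0)) 1)
      fun j => AddMonoidAlgebra.single (e.symm (Pi.single j 1, 0)) 1)

lemma modelLaurent_comp_modelHom :
    (modelLaurent ε e i).comp (modelHom hη ε e he) = laurentHom hη (lineCoord ε) := by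
  let W : Multiplicative ((Fin m → ℤ) × (Fin r → ℤ)) →*
      AddMonoidAlgebra (MvPolynomial Unit ℂ) (Fin n → ℤ) :=
    (AddMonoidAlgebra.of (MvPolynomial Unit ℂ) (Fin n → ℤ)).comp
      (AddMonoidHom.toMultiplicative (e.symm : _ →+ (Fin n → ℤ)))
  have hC : ∀ c : Fin r → ℤ, modelLaurent ε e i (MvPolynomial.C (AddMonoidAlgebra.single c 1))
      = W (Multiplicative.ofAdd (0, c)) := by
    intro c
    rw [modelLaurent, MvPolynomial.aevalTower_C, AddMonoidAlgebra.lift_single, one_smul]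
    rfl
  have h0 : modelLaurent ε e i (MvPolynomial.X 0) = algebraMap _ _ (lineCoord ε i) *
      W (Multiplicative.ofAdd (-1, 0)) := by
    rw [modelLaurent, MvPolynomial.aevalTower_X]
    rfl
  have h1 : ∀ j : Fin m, modelLaurent ε e i (MvPolynomial.X j.succ)
      = W (Multiplicative.ofAdd (Pi.single j 1, 0)) := by
    intro j
    rw [modelLaurent, MvPolynomial.aevalTower_X]
    rfl
  have hτ : ∀ j, modelLaurent ε e i (modelCoord m r ε i j) = algebraMap _ _ (lineCoord ε j) := by
    intro j
    have := monomial_prod_aux W 0 0 1 (by simp)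
    simp only [Pi.zero_apply, Nat.cast_one, add_zero, Int.toNat_one, pow_one] at this
    have hz : Multiplicative.ofAdd ((0, 0) : (Fin m → ℤ) × (Fin r → ℤ)) = 1 := rfl
    rw [hz, map_one, one_mul] at this
    rw [modelCoord, map_add, AlgHom.commutes, coordProd_eq, map_mul, map_prod, h0]
    simp only [h1]
    rw [mul_assoc, this, mul_one, IsScalarTower.algebraMap_apply ℂ (MvPolynomial Unit ℂ), ← map_add]
    congr 1
    simp only [lineCoord, MvPolynomial.algebraMap_eq, map_sub]
    ring
  refine toricRing_algHom_ext hη fun u a ha => ?_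
  have hnn : ∀ j, 0 ≤ (a i : ℤ) + (e u).1 j := by
    intro j
    have h1 : (-(e u).1 j).toNat ≤ η i u := by
      rw [he]
      exact Finset.le_sup (f := fun j => (-(e u).1 j).toNat) (Finset.mem_univ j)
    have := ha i
    omega
  have hW := monomial_prod_aux W (e u).1 (e u).2 (a i) hnn
  have hu : W (Multiplicative.ofAdd ((e u).1, (e u).2))
      = AddMonoidAlgebra.of (MvPolynomial Unit ℂ) (Fin n → ℤ) (Multiplicative.ofAdd u) := by
    change AddMonoidAlgebra.of _ _ (Multiplicative.ofAdd (e.symm (e u))) = _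
    rw [AddEquiv.symm_apply_apply]
  rw [AlgHom.comp_apply, modelHom_chi, laurentHom, toricHom_chi, ← hu, ← hW]
  simp only [map_mul, map_prod, map_pow, hC, h0, h1, hτ]
  rw [← Finset.mul_prod_erase Finset.univ _ (Finset.mem_univ i)]
  ring

/-- A monomial with exponents `s` determines `a i = s 0` and `v_j = s_j - s_0`, which already
satisfy the `i`-th inequality. The other inequalities are achieved by multiplying by powers of
`t_j`, `j ≠ i`. -/
lemma modelHom_exists_pow_mul_eq (b : ModelRing m r) :
    ∃ (N : ℕ) (a : ToricRing (cayleyCone M)),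
      modelHom hη ε e he (∏ j ∈ Finset.univ.erase i, t M j) ^ N * b = modelHom hη ε e he a := by
  induction b using mvPolynomial_torusRing_induction with
  | hmon s c =>
    let u := e.symm (fun j => (s j.succ : ℤ) - s 0, c)
    have hu : e u = (fun j => (s j.succ : ℤ) - s 0, c) := e.apply_symm_apply _
    -- The sum `∑ η j u` serves as one exponent dominating every `η j u`.
    refine ⟨∑ j, η j u, chi hη u (Function.update (fun _ => ∑ j, η j u) i (s 0)) ?_, ?_⟩
    · intro j
      by_cases h : j = i
      · subst h
        rw [Function.update_self, he, hu]
        refine Finset.sup_le fun l _ => ?_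
        simp only
        omega
      · rw [Function.update_of_ne h]
        exact Finset.single_le_sum (f := fun j => η j u) (fun _ _ => Nat.zero_le _)
          (Finset.mem_univ j)
    · rw [modelHom_chi, hu, map_prod]
      simp only [modelHom_t, Function.update_self, add_sub_cancel, Int.toNat_natCast]
      have h1 : ∀ N : ℕ, ∏ j ∈ Finset.univ.erase i, modelCoord m r ε i j ^
          (Function.update (fun _ => N) i (s 0) j)
          = (∏ j ∈ Finset.univ.erase i, modelCoord m r ε i j) ^ N := by
        intro N
        rw [← Finset.prod_pow]
        exact Finset.prod_congr rfl fun j hj => by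
          rw [Function.update_of_ne (Finset.ne_of_mem_erase hj)]
      rw [h1, mul_comm]
      congr 1
      rw [MvPolynomial.monomial_eq, Finsupp.prod_fintype _ _ (fun _ => pow_zero _),
        Fin.prod_univ_succ, mul_assoc]
  | hadd x y hx hy => exact exists_pow_mul_eq_add _ _ hx hy
  | hsmul c x hx =>
    obtain ⟨N, a, ha⟩ := hx
    exact ⟨N, c • a, by rw [mul_smul_comm, ha, map_smul]⟩

end Model

/-! ### The chart over the general points of the line -/

section Torus

variable (hη : ∀ i, IsSupport (M i) (η i)) (ε : Fin k → ℂ)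

/-- The chart over the complement of the points `ε i`. -/
def torusHom : ToricRing (cayleyCone M) →ₐ[ℂ] MvPolynomial Unit (TorusRing n) :=
  toricHom hη ((MvPolynomial.C : TorusRing n →+* _).toMonoidHom.comp
    (AddMonoidAlgebra.of ℂ (Fin n → ℤ))) fun i => MvPolynomial.X () - algebraMap ℂ _ (ε i)

/-- The Laurent expansion of the functions on the chart over the complement of the points `ε i`. -/
def torusLaurent : MvPolynomial Unit (TorusRing n) →ₐ[ℂ]
    AddMonoidAlgebra (MvPolynomial Unit ℂ) (Fin n → ℤ) :=
  MvPolynomial.aevalTower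
    (AddMonoidAlgebra.lift ℂ _ _ (AddMonoidAlgebra.of (MvPolynomial Unit ℂ) (Fin n → ℤ)))
    fun _ => algebraMap (MvPolynomial Unit ℂ) _ (MvPolynomial.X ())

lemma torusLaurent_comp_torusHom :
    torusLaurent.comp (torusHom hη ε) = laurentHom hη (lineCoord ε) := by
  refine toricRing_algHom_ext hη fun u a ha => ?_
  rw [AlgHom.comp_apply, torusHom, toricHom_chi, laurentHom, toricHom_chi, map_mul, map_prod]
  congr 1
  · change torusLaurent (MvPolynomial.C _) = _
    rw [torusLaurent, MvPolynomial.aevalTower_C, AddMonoidAlgebra.lift_of]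
  · refine Finset.prod_congr rfl fun i _ => ?_
    rw [map_pow, map_sub, AlgHom.commutes, torusLaurent, MvPolynomial.aevalTower_X,
      IsScalarTower.algebraMap_apply ℂ (MvPolynomial Unit ℂ), ← map_sub]
    rfl

lemma torusHom_exists_pow_mul_eq [NeZero k] (hε : ε 0 = 0) (b : MvPolynomial Unit (TorusRing n)) :
    ∃ (N : ℕ) (a : ToricRing (cayleyCone M)),
      torusHom hη ε (∏ j, t M j) ^ N * b = torusHom hη ε a := by
  induction b using mvPolynomial_torusRing_induction with
  | hmon s c =>
    refine ⟨∑ j, η j c, t M 0 ^ s () * chi hη c (fun _ => ∑ j, η j c) fun j =>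
      Finset.single_le_sum (f := fun j => η j c) (fun _ _ => Nat.zero_le _) (Finset.mem_univ j), ?_⟩
    rw [map_mul, map_pow, map_prod]
    simp only [torusHom, toricHom_t, toricHom_chi]
    rw [hε, map_zero, sub_zero, Finset.prod_pow, MvPolynomial.monomial_eq,
      Finsupp.prod_fintype _ _ (fun _ => pow_zero _)]
    simp
    ring
  | hadd x y hx hy => exact exists_pow_mul_eq_add _ _ hx hy
  | hsmul c x hx =>
    obtain ⟨N, a, ha⟩ := hx
    exact ⟨N, c • a, by rw [mul_smul_comm, ha, map_smul]⟩

end Torus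

end Charts

/-! ### Fibres and restrictions of morphisms to affine space -/

/-- The fibre over `a` is cut out by the equations `h j = a j`; any surjection with that kernel
realises it. -/
lemma isPushout_fibre {J A B : Type} [CommRing A] [Algebra ℂ A] [CommRing B] [Algebra ℂ B]
    (h : J → A) (a : J → ℂ) (π : A →ₐ[ℂ] B) (hπ : Function.Surjective π)
    (hker : ∀ x, π x = 0 ↔ x ∈ Ideal.span (Set.range fun j => h j - algebraMap ℂ A (a j))) :
    IsPushout (CommRingCat.ofHom (MvPolynomial.aeval (R := ℂ) h).toRingHom)
      (CommRingCat.ofHom (MvPolynomial.eval a)) (CommRingCat.ofHom π.toRingHom)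
      (CommRingCat.ofHom (algebraMap ℂ B)) := by
  have hw : CommRingCat.ofHom (MvPolynomial.aeval (R := ℂ) h).toRingHom ≫
      CommRingCat.ofHom π.toRingHom = CommRingCat.ofHom (MvPolynomial.eval a) ≫
      CommRingCat.ofHom (algebraMap ℂ B) := by
    rw [← CommRingCat.ofHom_comp, ← CommRingCat.ofHom_comp]
    congr 1
    apply MvPolynomial.ringHom_ext
    · intro c
      simp
    · intro j
      have := (hker (h j - algebraMap ℂ A (a j))).2 (Ideal.subset_span ⟨j, rfl⟩)
      rw [map_sub, AlgHom.commutes, sub_eq_zero] at this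
      simpa using this
  have hle : ∀ s : Limits.PushoutCocone
      (CommRingCat.ofHom (MvPolynomial.aeval (R := ℂ) h).toRingHom)
      (CommRingCat.ofHom (MvPolynomial.eval a)),
      (RingHom.ker π.toRingHom) ≤ RingHom.ker s.inl.hom := by
    intro s x hx
    have hx' := (hker x).1 hx
    refine (Ideal.span_le.2 ?_ : _ ≤ RingHom.ker s.inl.hom) hx'
    rintro _ ⟨j, rfl⟩
    have h1 := ConcreteCategory.congr_hom s.condition (MvPolynomial.X j)
    have h2 := ConcreteCategory.congr_hom s.condition (MvPolynomial.C (a j))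
    simp at h1 h2
    simp [RingHom.mem_ker, h1, h2]
  have hlift : ∀ s x, RingHom.liftOfSurjective π.toRingHom hπ ⟨s.inl.hom, hle s⟩ (π.toRingHom x)
      = s.inl.hom x := fun s x => RingHom.liftOfRightInverse_comp_apply _ _ _ _ _
  refine ⟨⟨hw⟩, ⟨Limits.PushoutCocone.IsColimit.mk _
    (fun s => CommRingCat.ofHom (RingHom.liftOfSurjective π.toRingHom hπ
      ⟨s.inl.hom, hle s⟩)) (fun s => ?_) (fun s => ?_) (fun s m hm _ => ?_)⟩⟩
  · ext x
    exact hlift s x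
  · ext c
    have h2 := ConcreteCategory.congr_hom s.condition (MvPolynomial.C c)
    simp only [CommRingCat.hom_comp, RingHom.comp_apply, CommRingCat.hom_ofHom,
      MvPolynomial.eval_C] at h2
    refine Eq.trans ?_ h2
    have h3 : algebraMap ℂ B c = π.toRingHom ((MvPolynomial.aeval (R := ℂ) h).toRingHom
        (MvPolynomial.C c)) := by simp
    rw [CommRingCat.hom_comp, RingHom.comp_apply, CommRingCat.hom_ofHom, CommRingCat.hom_ofHom, h3]
    exact hlift s _
  · ext x
    obtain ⟨x, rfl⟩ := hπ x
    exact (ConcreteCategory.congr_hom hm x).trans (hlift s x).symm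

lemma isPullback_fibre {J A B : Type} [CommRing A] [Algebra ℂ A] [CommRing B] [Algebra ℂ B]
    (h : J → A) (a : J → ℂ) (π : A →ₐ[ℂ] B) (hπ : Function.Surjective π)
    (hker : ∀ x, π x = 0 ↔ x ∈ Ideal.span (Set.range fun j => h j - algebraMap ℂ A (a j))) :
    IsPullback (Spec.map (CommRingCat.ofHom π.toRingHom))
      (Spec.map (CommRingCat.ofHom (algebraMap ℂ B))) (toAffineSpace h) (point a) :=
  isPullback_SpecMap_of_isPushout _ _ _ _ (isPushout_fibre h a π hπ hker)

lemma fibre_iso_of_isPullback {J : Type} {X P : Scheme} {g : X ⟶ affineSpace J} {a : J → ℂ}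
    {p : P ⟶ X} {q : P ⟶ Spec (CommRingCat.of ℂ)} (h : IsPullback p q g (point a)) :
    Nonempty (fibre g a ≅ Over.mk q) :=
  ⟨(Over.isoMk h.isoPullback (by simp [fibre])).symm⟩

lemma nonempty_restrict_iso {X Y Z S : Scheme} (f : X ⟶ S) (f' : Y ⟶ S) (U : S.Opens)
    (j : Z ⟶ X) (j' : Z ⟶ Y) [IsOpenImmersion j] [IsOpenImmersion j'] (h : j ≫ f = j' ≫ f')
    (hj : Set.range j = f ⁻¹' U) (hj' : Set.range j' = f' ⁻¹' U) :
    Nonempty (Over.mk (f ∣_ U) ≅ Over.mk (f' ∣_ U)) := by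
  let a := IsOpenImmersion.isoOfRangeEq (f ⁻¹ᵁ U).ι j (by rw [hj]; simp)
  let b := IsOpenImmersion.isoOfRangeEq (f' ⁻¹ᵁ U).ι j' (by rw [hj']; simp)
  refine ⟨Over.isoMk (a ≪≫ b.symm) ?_⟩
  rw [← cancel_mono U.ι]
  simp [a, b, ← h]

/-- The point factors through `U`, so by pasting pullback squares its fibre only depends on the
restriction over `U`. -/
lemma fibre_iso_of_restrict_iso {J : Type} {X Y : Scheme} (f : X ⟶ affineSpace J)
    (f' : Y ⟶ affineSpace J) (U : (affineSpace J).Opens)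
    (e : Over.mk (f ∣_ U) ≅ Over.mk (f' ∣_ U)) (a : J → ℂ) (ha : Set.range (point a) ⊆ U) :
    Nonempty (fibre f a ≅ fibre f' a) := by
  let p : Spec (CommRingCat.of ℂ) ⟶ U := IsOpenImmersion.lift U.ι (point a) (by simpa using ha)
  have hp : p ≫ U.ι = point a := IsOpenImmersion.lift_fac _ _ _
  have h0 := IsPullback.of_hasPullback (f ∣_ U) p
  have h1 := h0.flip.paste_vert (isPullback_morphismRestrict f U)
  have : IsIso e.hom.left := inferInstanceAs (IsIso ((Over.forget _).map e.hom))
  have h2 : IsPullback (f ∣_ U) e.hom.left (𝟙 _) (f' ∣_ U) :=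
    IsPullback.of_vert_isIso ⟨by simpa using (Over.w e.hom).symm⟩
  have h3 := h0.flip.paste_vert (h2.paste_vert (isPullback_morphismRestrict f' U))
  rw [hp] at h1
  rw [Category.id_comp, hp] at h3
  obtain ⟨e1⟩ := fibre_iso_of_isPullback h1.flip
  obtain ⟨e2⟩ := fibre_iso_of_isPullback h3.flip
  exact ⟨e1 ≪≫ e2.symm⟩

/-- The complement of a hypersurface in affine space. -/
def nonvanishing {J : Type} (G : MvPolynomial J ℂ) : (affineSpace J).Opens :=
  PrimeSpectrum.basicOpen G

lemma range_point_subset {J : Type} (a : J → ℂ) (G : MvPolynomial J ℂ)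
    (h : MvPolynomial.eval a G ≠ 0) :
    Set.range (point a) ⊆ nonvanishing G := by
  rintro _ ⟨x, rfl⟩
  change MvPolynomial.eval a G ∉ x.asIdeal
  intro hx
  exact x.isPrime.ne_top (Ideal.eq_top_of_isUnit_mem _ hx (Ne.isUnit h))

lemma range_SpecMap_away {J D L : Type} [CommRing D] [Algebra ℂ D] [CommRing L] [Algebra D L]
    (h : J → D) (G : MvPolynomial J ℂ) [IsLocalization.Away (MvPolynomial.aeval h G) L] :
    Set.range (Spec.map (CommRingCat.ofHom (algebraMap D L)))
      = toAffineSpace h ⁻¹' nonvanishing G :=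
  PrimeSpectrum.localization_away_comap_range L (MvPolynomial.aeval h G)

/-- Both preimages of the open set are the image of the same scheme `Spec L`. -/
lemma nonempty_restrict_iso_of_isLocalization {J D B L : Type} [CommRing D] [Algebra ℂ D]
    [CommRing B] [Algebra ℂ B] [CommRing L] [Algebra D L] [Algebra B L] (h : J → D) (h' : J → B)
    (φ : D →ₐ[ℂ] B) (hφ : (algebraMap B L).comp φ.toRingHom = algebraMap D L)
    (hh : ∀ j, φ (h j) = h' j) (G : MvPolynomial J ℂ)
    [IsLocalization.Away (MvPolynomial.aeval h G) L]
    [IsLocalization.Away (MvPolynomial.aeval h' G) L] {X : Scheme}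
    (E : X ≅ Spec (CommRingCat.of D)) (f : X ⟶ affineSpace J) (hf : E.hom ≫ toAffineSpace h = f) :
    Nonempty (Over.mk (f ∣_ nonvanishing G) ≅
      Over.mk (toAffineSpace h' ∣_ nonvanishing G)) := by
  have := IsOpenImmersion.of_isLocalization (S := L) (MvPolynomial.aeval h G)
  have := IsOpenImmersion.of_isLocalization (S := L) (MvPolynomial.aeval h' G)
  refine nonempty_restrict_iso _ _ _
    (Spec.map (CommRingCat.ofHom (algebraMap D L)) ≫ E.inv)
    (Spec.map (CommRingCat.ofHom (algebraMap B L))) ?_ ?_ (range_SpecMap_away h' G)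
  · rw [← hf, Category.assoc, Iso.inv_hom_id_assoc, toAffineSpace, toAffineSpace, ← Spec.map_comp,
      ← Spec.map_comp, ← CommRingCat.ofHom_comp, ← CommRingCat.ofHom_comp, ← hφ]
    congr 2
    apply MvPolynomial.ringHom_ext
    · intro c
      simp
    · intro j
      simp [hh]
  · have h1 := range_SpecMap_away (L := L) h G
    ext x
    have h2 : x ∈ f ⁻¹' nonvanishing G ↔
        E.hom x ∈ toAffineSpace h ⁻¹' nonvanishing G := by
      rw [← hf]
      simp
    rw [h2, ← h1]
    constructor
    · rintro ⟨y, rfl⟩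
      exact ⟨y, by simp⟩
    · rintro ⟨y, hy⟩
      refine ⟨y, ?_⟩
      rw [Scheme.Hom.comp_apply, hy]
      simp

/-! ### Smoothness -/

lemma smooth_iff_of_iso {S : Scheme} {X Y : Over S} (e : X ≅ Y) : Smooth X.hom ↔ Smooth Y.hom := by
  have key : ∀ {X Y : Over S}, (X ≅ Y) → Smooth Y.hom → Smooth X.hom := by
    intro X Y e _
    have : IsIso e.hom.left := inferInstanceAs (IsIso ((Over.forget _).map e.hom))
    rw [← Over.w e.hom]
    infer_instance
  exact ⟨key e.symm, key e⟩

lemma smooth_specOver_iff (A : Type) [CommRing A] [Algebra ℂ A] :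
    Smooth (specOver A).hom ↔ Algebra.Smooth ℂ A := by
  refine (HasRingHomProperty.Spec_iff (P := @Smooth)).trans ?_
  exact RingHom.smooth_algebraMap

/-- A homomorphism from the torus ring is a choice of `r` units, and units lift along nilpotent
ideals. -/
lemma formallySmooth_torusRing (r : ℕ) : Algebra.FormallySmooth ℂ (TorusRing r) := by
  refine Algebra.FormallySmooth.of_comp_surjective fun B _ _ I hI g => ?_
  have hI' : IsNilpotent I := ⟨2, hI⟩
  have hu : ∀ j : Fin r, ∃ b : Bˣ, Ideal.Quotient.mk I b
      = g (AddMonoidAlgebra.single (Pi.single j 1) 1) := by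
    intro j
    obtain ⟨b, hb⟩ := Ideal.Quotient.mk_surjective (g (AddMonoidAlgebra.single (Pi.single j 1) 1))
    have hb' : IsUnit (Ideal.Quotient.mk I b) := by
      rw [hb]
      refine IsUnit.of_mul_eq_one (g (AddMonoidAlgebra.single (-Pi.single j 1) 1)) ?_
      rw [← map_mul, AddMonoidAlgebra.single_mul_single, add_neg_cancel, one_mul,
        ← AddMonoidAlgebra.one_def, map_one]
    obtain ⟨u, rfl⟩ := (hI'.isUnit_quotient_mk_iff).1 hb'
    exact ⟨u, hb⟩
  choose b hb using hu
  let w : Multiplicative (Fin r → ℤ) →* Bˣ :=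
    { toFun := fun c => ∏ j, b j ^ (c.toAdd j)
      map_one' := by simp
      map_mul' := fun c d => by
        rw [← Finset.prod_mul_distrib]
        exact Finset.prod_congr rfl fun j _ => zpow_add _ _ _ }
  have hw : ∀ j, w (Multiplicative.ofAdd (Pi.single j 1)) = b j := by
    intro j
    change ∏ l, b l ^ ((Pi.single j 1 : Fin r → ℤ) l) = _
    rw [Finset.prod_eq_single j (fun l _ hl => by simp [hl]) (by simp)]
    simp
  refine ⟨AddMonoidAlgebra.lift ℂ B _ ((Units.coeHom B).comp w), ?_⟩
  have key : (((Ideal.Quotient.mkₐ ℂ I).comp (AddMonoidAlgebra.lift ℂ B _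
      ((Units.coeHom B).comp w)) : TorusRing r →* B ⧸ I).comp (AddMonoidAlgebra.of ℂ (Fin r → ℤ)))
      = (g : TorusRing r →* B ⧸ I).comp (AddMonoidAlgebra.of ℂ (Fin r → ℤ)) := by
    apply AddMonoidHom.toMultiplicativeLeft.symm.injective
    refine AddMonoidHom.functions_ext' _ _ _ (fun j => AddMonoidHom.ext_int ?_)
    change Ideal.Quotient.mk I (AddMonoidAlgebra.lift ℂ B _ ((Units.coeHom B).comp w)
      (AddMonoidAlgebra.single (Pi.single j 1) 1)) = g (AddMonoidAlgebra.single (Pi.single j 1) 1)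
    rw [AddMonoidAlgebra.lift_single, one_smul, ← hb, ← hw]
    rfl
  exact AddMonoidAlgebra.algHom_ext' key (by ext)

instance smooth_torusRing (r : ℕ) : Algebra.Smooth ℂ (TorusRing r) where
  formallySmooth := formallySmooth_torusRing r
  finitePresentation := by
    have : AddMonoid.FG (Fin r → ℤ) := inferInstance
    exact Algebra.FinitePresentation.of_finiteType.1 inferInstance

instance smooth_mvPolynomial_torusRing (J : Type) [Finite J] (r : ℕ) :
    Algebra.Smooth ℂ (MvPolynomial J (TorusRing r)) :=
  have : Algebra.Smooth (TorusRing r) (MvPolynomial J (TorusRing r)) := {}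
  Algebra.Smooth.comp ℂ (TorusRing r) _

lemma mem_span_X_sub_C_iff {J T : Type} [Unique J] [CommRing T] (c : T) (p : MvPolynomial J T) :
    MvPolynomial.eval (fun _ => c) p = 0 ↔
      p ∈ Ideal.span {(MvPolynomial.X default - MvPolynomial.C c : MvPolynomial J T)} := by
  constructor
  · intro hp
    set I := Ideal.span {(MvPolynomial.X default - MvPolynomial.C c : MvPolynomial J T)}
    have h : Ideal.Quotient.mk I = ((Ideal.Quotient.mk I).comp MvPolynomial.C).comp
        (MvPolynomial.eval fun _ => c) := by
      apply MvPolynomial.ringHom_ext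
      · intro r
        simp
      · intro j
        rw [Unique.eq_default j]
        simp only [RingHom.comp_apply, MvPolynomial.eval_X]
        exact Ideal.Quotient.eq.2 (Ideal.subset_span rfl)
    rw [← Ideal.Quotient.eq_zero_iff_mem, h, RingHom.comp_apply, hp, map_zero]
  · intro hp
    have : Ideal.span {(MvPolynomial.X default - MvPolynomial.C c : MvPolynomial J T)}
        ≤ RingHom.ker (MvPolynomial.eval fun _ => c) := by
      rw [Ideal.span_le]
      rintro _ rfl
      simp [RingHom.mem_ker]
    exact this hp

lemma smooth_singularModel_zero (r : ℕ) :
    Algebra.Smooth ℂ (ModelRing 0 r ⧸ Ideal.span {coordProd 0 r}) := by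
  let π : ModelRing 0 r →ₐ[ℂ] TorusRing r :=
    (MvPolynomial.aeval (R := TorusRing r) fun _ => 0).restrictScalars ℂ
  have hπ : Function.Surjective π := fun x => ⟨MvPolynomial.C x, by simp [π]⟩
  have hker : RingHom.ker π = Ideal.span {coordProd 0 r} := by
    ext p
    have := mem_span_X_sub_C_iff (J := Fin 1) (0 : TorusRing r) p
    rw [map_zero, sub_zero] at this
    simp only [coordProd, Fin.prod_univ_succ, Finset.univ_eq_empty, Finset.prod_empty, mul_one]
    refine Iff.trans ?_ this
    simp [π, RingHom.mem_ker]
  exact Algebra.Smooth.of_equiv ((Ideal.quotientEquivAlgOfEq ℂ hker.symm).trans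
    (Ideal.quotientKerAlgEquivOfSurjective hπ)).symm

lemma exists_lift_of_surjective {A B C : Type} [CommRing A] [Algebra ℂ A] [CommRing B]
    [Algebra ℂ B] [CommRing C] [Algebra ℂ C] [Algebra.FormallySmooth ℂ A] (f : A →ₐ[ℂ] C)
    (g : B →ₐ[ℂ] C) (hg : Function.Surjective g) (hker : ∀ x y, g x = 0 → g y = 0 → x * y = 0) :
    ∃ f' : A →ₐ[ℂ] B, ∀ x, g (f' x) = f x := by
  have hnil : IsNilpotent (RingHom.ker (g : B →+* C)) := by
    refine ⟨2, ?_⟩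
    rw [pow_two, Ideal.zero_eq_bot, eq_bot_iff, Ideal.mul_le]
    exact fun x hx y hy => hker x y hx hy
  exact ⟨Algebra.FormallySmooth.liftOfSurjective f g hg hnil,
    Algebra.FormallySmooth.liftOfSurjective_apply f g hg hnil⟩

/-- The arc `(s, s, 1, …, 1)` satisfies the equation modulo `s^2`, but every lift of it modulo `s^3`
has product `s^2 ≠ 0`. This contradicts infinitesimal lifting. -/
lemma not_smooth_singularModel {m : ℕ} (hm : m ≠ 0) (r : ℕ) :
    ¬ Algebra.Smooth ℂ (ModelRing m r ⧸ Ideal.span {coordProd m r}) := by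
  intro h
  -- Exponents of the arc: two coordinates vanish to first order, which requires `m ≠ 0`.
  let d : Fin (m + 1) → ℕ := fun j => if (j : ℕ) < 2 then 1 else 0
  have hd : ∑ j, d j = 2 := by
    obtain ⟨m, rfl⟩ := Nat.exists_eq_succ_of_ne_zero hm
    simp only [d]
    rw [Fin.sum_univ_succ, Fin.sum_univ_succ]
    simp
  let I : ℕ → Ideal (Polynomial ℂ) := fun N => Ideal.span {Polynomial.X ^ N}
  have hI : I 3 ≤ I 2 := by
    rw [Ideal.span_singleton_le_span_singleton]
    exact pow_dvd_pow _ (by norm_num)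
  let f₀ : ModelRing m r →ₐ[ℂ] Polynomial ℂ ⧸ I 2 :=
    MvPolynomial.aevalTower (AddMonoidAlgebra.lift ℂ _ _ 1)
      fun j => Ideal.Quotient.mk _ (Polynomial.X ^ d j)
  have hf₀ : ∀ x ∈ Ideal.span {coordProd m r}, f₀ x = 0 := by
    intro x hx
    have : Ideal.span {coordProd m r} ≤ RingHom.ker f₀ := by
      rw [Ideal.span_le]
      rintro _ rfl
      change f₀ _ = 0
      simp only [f₀, coordProd, map_prod, MvPolynomial.aevalTower_X]
      rw [← map_prod, Finset.prod_pow_eq_pow_sum, hd]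
      exact Ideal.Quotient.eq_zero_iff_mem.2 (Ideal.subset_span rfl)
    exact this hx
  let f := Ideal.Quotient.liftₐ _ f₀ hf₀
  let g : (Polynomial ℂ ⧸ I 3) →ₐ[ℂ] Polynomial ℂ ⧸ I 2 := Ideal.Quotient.factorₐ ℂ hI
  have hg : Function.Surjective g := Ideal.Quotient.factor_surjective hI
  have hker : ∀ x y, g x = 0 → g y = 0 → x * y = 0 := by
    intro x y hx hy
    obtain ⟨x, rfl⟩ := Ideal.Quotient.mk_surjective x
    obtain ⟨y, rfl⟩ := Ideal.Quotient.mk_surjective y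
    have hx' : x ∈ I 2 := Ideal.Quotient.eq_zero_iff_mem.1 hx
    have hy' : y ∈ I 2 := Ideal.Quotient.eq_zero_iff_mem.1 hy
    rw [Ideal.mem_span_singleton] at hx' hy'
    rw [← map_mul, Ideal.Quotient.eq_zero_iff_mem, Ideal.mem_span_singleton]
    exact (pow_dvd_pow _ (by norm_num)).trans (pow_add (Polynomial.X : Polynomial ℂ) 2 2 ▸
      mul_dvd_mul hx' hy')
  obtain ⟨f', hf'⟩ := exists_lift_of_surjective
    (A := ModelRing m r ⧸ Ideal.span {coordProd m r}) f g hg hker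
  choose p hp using fun j : Fin (m + 1) => Ideal.Quotient.mk_surjective
    (f' (Ideal.Quotient.mk _ (MvPolynomial.X j)))
  have hq : ∀ j, ∃ q : Polynomial ℂ, p j = Polynomial.X ^ d j * (1 + Polynomial.X * q) := by
    intro j
    have h1 : Ideal.Quotient.mk (I 2) (p j) = Ideal.Quotient.mk (I 2) (Polynomial.X ^ d j) := by
      have h2 : Ideal.Quotient.mk (I 2) (p j) = g (Ideal.Quotient.mk (I 3) (p j)) := rfl
      rw [h2, hp, hf']
      change f₀ _ = _
      simp [f₀]
    rw [Ideal.Quotient.eq, Ideal.mem_span_singleton] at h1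
    obtain ⟨q, hq⟩ := h1
    rw [sub_eq_iff_eq_add] at hq
    by_cases hj : (j : ℕ) < 2
    · refine ⟨q, ?_⟩
      rw [hq]
      simp only [d, hj, if_true]
      ring
    · refine ⟨Polynomial.X * q, ?_⟩
      rw [hq]
      simp only [d, hj, if_false]
      ring
  choose q hq using hq
  have h0 : ∏ j, p j ∈ I 3 := by
    rw [← Ideal.Quotient.eq_zero_iff_mem, map_prod]
    simp only [hp]
    rw [← map_prod, ← map_prod]
    have : Ideal.Quotient.mk (Ideal.span {coordProd m r}) (∏ j, MvPolynomial.X j) = 0 :=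
      Ideal.Quotient.eq_zero_iff_mem.2 (Ideal.subset_span rfl)
    rw [this, map_zero]
  rw [Ideal.mem_span_singleton] at h0
  simp only [hq, Finset.prod_mul_distrib] at h0
  rw [Finset.prod_pow_eq_pow_sum, hd, pow_succ _ 2] at h0
  -- Cancelling `X ^ 2` would make `X` divide a product whose value at `0` is `1`.
  have h3 := (mul_dvd_mul_iff_left (pow_ne_zero 2 Polynomial.X_ne_zero)).1 h0
  rw [Polynomial.X_dvd_iff, Polynomial.coeff_zero_eq_eval_zero, Polynomial.eval_prod] at h3
  simp at h3

/-! ### The deformation -/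

section Deformation

variable {n k : ℕ} [NeZero k] {M : Fin k → Set (Fin n → ℝ)} {η : Fin k → (Fin n → ℤ) → ℕ}

lemma isPullback_deformation (M : Fin k → Set (Fin n → ℝ)) (ε : Fin k → ℂ) :
    IsPullback (Spec.map (CommRingCat.ofHom (Ideal.Quotient.mk (deformationIdeal M ε))))
      (Spec.map (CommRingCat.ofHom (algebraMap ℂ (DeformationRing M ε)))) (Psi M)
      (point (fun i : {i : Fin k // i ≠ 0} => ε i.1)) :=
  isPullback_fibre (fun i : {i : Fin k // i ≠ 0} => t M 0 - t M i.1) (fun i => ε i.1)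
    (Ideal.Quotient.mkₐ ℂ (deformationIdeal M ε)) Ideal.Quotient.mk_surjective
    fun _ => Ideal.Quotient.eq_zero_iff_mem

/-- The deformation is the spectrum of the deformation ring. -/
def deformationIso (M : Fin k → Set (Fin n → ℝ)) (ε : Fin k → ℂ) :
    (deformation M ε).left ≅ Spec (CommRingCat.of (DeformationRing M ε)) :=
  (isPullback_deformation M ε).isoPullback.symm

lemma deformationIso_hom_comp (M : Fin k → Set (Fin n → ℝ)) (ε : Fin k → ℂ) :
    (deformationIso M ε).hom ≫ toAffineSpace (fun _ : Unit =>
      Ideal.Quotient.mk (deformationIdeal M ε) (t M 0)) = projection M ε := by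
  have h1 : (deformationIso M ε).hom ≫
      Spec.map (CommRingCat.ofHom (Ideal.Quotient.mk (deformationIdeal M ε)))
      = Limits.pullback.fst _ _ := (isPullback_deformation M ε).isoPullback_inv_fst
  refine Eq.trans ?_ (congrArg (fun f => f ≫ toAffineSpace (fun _ : Unit => t M 0)) h1)
  refine Eq.trans ?_ (Category.assoc _ _ _).symm
  congr 1
  rw [toAffineSpace, toAffineSpace]
  refine Eq.trans ?_ (Spec.map_comp _ _)
  congr 1
  rw [← CommRingCat.ofHom_comp]
  congr 1
  apply MvPolynomial.ringHom_ext
  · intro c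
    simp
    rfl
  · intro j
    simp

/-- Matches the open subset `lineMinus ε s` of the line with the element inverted in the chart. -/
lemma aeval_mk_t (M : Fin k → Set (Fin n → ℝ)) {ε : Fin k → ℂ} (hε : ε 0 = 0)
    (s : Finset (Fin k)) :
    MvPolynomial.aeval (fun _ : Unit => Ideal.Quotient.mk (deformationIdeal M ε) (t M 0))
      (∏ i ∈ s, (MvPolynomial.X () - MvPolynomial.C (ε i)))
      = Ideal.Quotient.mk (deformationIdeal M ε) (∏ i ∈ s, t M i) := by
  rw [map_prod, map_prod]
  refine Finset.prod_congr rfl fun i _ => ?_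
  rw [map_sub, MvPolynomial.aeval_X, MvPolynomial.algHom_C]
  change _ - Ideal.Quotient.mk (deformationIdeal M ε) (algebraMap ℂ _ (ε i)) = _
  rw [← map_sub, Ideal.Quotient.eq]
  by_cases hi : i = 0
  · subst hi
    rw [hε, map_zero, sub_zero, sub_self]
    exact zero_mem _
  · rw [sub_right_comm]
    exact Ideal.subset_span ⟨⟨i, hi⟩, rfl⟩

lemma nonempty_restrict_projection_iso (hη : ∀ i, IsSupport (M i) (η i)) {ε : Fin k → ℂ}
    (hε : ε 0 = 0) {B : Type} [CommRing B] [Algebra ℂ B] (φ : ToricRing (cayleyCone M) →ₐ[ℂ] B)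
    (hφ : ∀ i, φ (t M 0) - φ (t M i) = algebraMap ℂ B (ε i))
    (β : B →ₐ[ℂ] AddMonoidAlgebra (MvPolynomial Unit ℂ) (Fin n → ℤ))
    (hβ : β.comp φ = laurentHom hη (lineCoord ε)) (s : Finset (Fin k))
    (hg : ∀ b : B, ∃ (N : ℕ) (a : ToricRing (cayleyCone M)), φ (∏ i ∈ s, t M i) ^ N * b = φ a) :
    Nonempty (Over.mk (projection M ε ∣_ lineMinus ε s) ≅
      Over.mk (toAffineSpace (fun _ : Unit => φ (t M 0)) ∣_ lineMinus ε s)) := by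
  let ψ : DeformationRing M ε →ₐ[ℂ] B :=
    Ideal.Quotient.liftₐ (deformationIdeal M ε) φ (deformationIdeal_le_ker φ hφ)
  let L := Localization.Away (φ (∏ i ∈ s, t M i))
  let : Algebra (DeformationRing M ε) L := ((algebraMap B L).comp ψ.toRingHom).toAlgebra
  have h1 : IsLocalization.Away (MvPolynomial.aeval
      (fun _ : Unit => Ideal.Quotient.mk (deformationIdeal M ε) (t M 0))
      (∏ i ∈ s, (MvPolynomial.X () - MvPolynomial.C (ε i)))) L := by
    rw [aeval_mk_t M hε]
    exact isLocalization_away_deformationRing hη hε φ hφ β hβ _ hg L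
  have h2 : IsLocalization.Away (MvPolynomial.aeval (fun _ : Unit => φ (t M 0))
      (∏ i ∈ s, (MvPolynomial.X () - MvPolynomial.C (ε i)))) L := by
    have : (MvPolynomial.aeval (fun _ : Unit => φ (t M 0)) : MvPolynomial Unit ℂ →ₐ[ℂ] B)
        = ψ.comp (MvPolynomial.aeval
          (fun _ : Unit => Ideal.Quotient.mk (deformationIdeal M ε) (t M 0))) := by
      ext i
      rw [AlgHom.comp_apply, MvPolynomial.aeval_X, MvPolynomial.aeval_X]
      rfl
    rw [this, AlgHom.comp_apply, aeval_mk_t M hε]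
    exact inferInstanceAs (IsLocalization.Away (φ (∏ i ∈ s, t M i)) L)
  have h3 := nonempty_restrict_iso_of_isLocalization (L := L)
    (fun _ : Unit => Ideal.Quotient.mk (deformationIdeal M ε) (t M 0))
    (fun _ : Unit => φ (t M 0)) ψ rfl (fun _ => rfl)
    (∏ i ∈ s, (MvPolynomial.X () - MvPolynomial.C (ε i))) (deformationIso M ε)
    (projection M ε) (deformationIso_hom_comp M ε)
  exact h3

/-- A maximal ideal containing all these products would contain `t_i` and `t_j` for some `i ≠ j`,
hence the non-zero constant `ε i - ε j`. -/
lemma span_prod_t_eq_top (M : Fin k → Set (Fin n → ℝ)) {ε : Fin k → ℂ} (hε : ε 0 = 0)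
    (hinj : Function.Injective ε) :
    Ideal.span (Set.range fun i => Ideal.Quotient.mk (deformationIdeal M ε)
      (∏ j ∈ Finset.univ.erase i, t M j)) = ⊤ := by
  by_contra h
  obtain ⟨P, hP, hle⟩ := Ideal.exists_le_maximal _ h
  have hmem : ∀ i, ∃ j, j ≠ i ∧ Ideal.Quotient.mk (deformationIdeal M ε) (t M j) ∈ P := by
    intro i
    have : Ideal.Quotient.mk (deformationIdeal M ε) (∏ j ∈ Finset.univ.erase i, t M j) ∈ P :=
      hle (Ideal.subset_span ⟨i, rfl⟩)
    rw [map_prod, hP.isPrime.prod_mem_iff] at this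
    obtain ⟨j, hj, hj'⟩ := this
    exact ⟨j, Finset.ne_of_mem_erase hj, hj'⟩
  have ht : ∀ i, Ideal.Quotient.mk (deformationIdeal M ε) (t M i)
      = Ideal.Quotient.mk (deformationIdeal M ε) (t M 0) - algebraMap ℂ _ (ε i) := by
    intro i
    have := aeval_mk_t M hε {i}
    simp only [Finset.prod_singleton, map_sub, MvPolynomial.aeval_X, MvPolynomial.algHom_C] at this
    exact this.symm
  obtain ⟨i, -, hi⟩ := hmem 0
  obtain ⟨j, hij, hj⟩ := hmem i
  have h3 := sub_mem hj hi
  rw [ht, ht i, sub_sub_sub_cancel_left, ← map_sub] at h3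
  refine hP.ne_top (Ideal.eq_top_of_isUnit_mem _ h3 ?_)
  exact (Ne.isUnit (sub_ne_zero.2 (hinj.ne hij.symm))).map _

/-- Smoothness is local on the deformation, and each piece of the cover is a localization of a
smooth model ring. -/
lemma smooth_deformation (hη : ∀ i, IsSupport (M i) (η i)) {ε : Fin k → ℂ} (hε : ε 0 = 0)
    (hinj : Function.Injective ε) (m r : Fin k → ℕ)
    (φ : ∀ i, ToricRing (cayleyCone M) →ₐ[ℂ] ModelRing (m i) (r i))
    (hφ : ∀ i j, φ i (t M 0) - φ i (t M j) = algebraMap ℂ _ (ε j))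
    (β : ∀ i, ModelRing (m i) (r i) →ₐ[ℂ] AddMonoidAlgebra (MvPolynomial Unit ℂ) (Fin n → ℤ))
    (hβ : ∀ i, (β i).comp (φ i) = laurentHom hη (lineCoord ε))
    (hg : ∀ i b, ∃ (N : ℕ) (a : ToricRing (cayleyCone M)),
      φ i (∏ j ∈ Finset.univ.erase i, t M j) ^ N * b = φ i a) :
    Smooth (deformation M ε).hom := by
  obtain ⟨e⟩ := fibre_iso_of_isPullback (isPullback_deformation M ε)
  refine (smooth_iff_of_iso e).2 ?_
  refine (smooth_specOver_iff (DeformationRing M ε)).2 ?_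
  rw [← RingHom.smooth_algebraMap]
  refine RingHom.Smooth.ofLocalizationSpanTarget _ _ (span_prod_t_eq_top M hε hinj) ?_
  rintro ⟨_, i, rfl⟩
  let L := Localization.Away (φ i (∏ j ∈ Finset.univ.erase i, t M j))
  let : Algebra (DeformationRing M ε) L := ((algebraMap (ModelRing (m i) (r i)) L).comp
    (Ideal.Quotient.lift (deformationIdeal M ε) (φ i : _ →+* _)
      (deformationIdeal_le_ker (φ i) (hφ i)))).toAlgebra
  have h1 : IsLocalization.Away (Ideal.Quotient.mk (deformationIdeal M ε)
      (∏ j ∈ Finset.univ.erase i, t M j)) L :=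
    isLocalization_away_deformationRing hη hε (φ i) (hφ i) (β i) (hβ i) _ (hg i) L
  have h2 : (algebraMap ℂ L).Smooth := by
    rw [IsScalarTower.algebraMap_eq ℂ (ModelRing (m i) (r i)) L]
    exact RingHom.Smooth.comp (RingHom.smooth_algebraMap.2 inferInstance)
      (RingHom.Smooth.holdsForLocalizationAway _ (φ i (∏ j ∈ Finset.univ.erase i, t M j)))
  -- Carries smoothness from the localized model `L` to the standard localization of the deformation
  -- ring.
  let e' := IsLocalization.algEquiv (Submonoid.powers (Ideal.Quotient.mk (deformationIdeal M ε)
      (∏ j ∈ Finset.univ.erase i, t M j))) L (Localization.Away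
      (Ideal.Quotient.mk (deformationIdeal M ε) (∏ j ∈ Finset.univ.erase i, t M j)))
  have h3 : (algebraMap (DeformationRing M ε) (Localization.Away
      (Ideal.Quotient.mk (deformationIdeal M ε) (∏ j ∈ Finset.univ.erase i, t M j)))).comp
      (algebraMap ℂ (DeformationRing M ε)) = (e' : L →+* _).comp (algebraMap ℂ L) := by
    ext c
    have h4 : algebraMap ℂ L c = algebraMap (DeformationRing M ε) L (algebraMap ℂ _ c) := by
      change algebraMap ℂ L c = algebraMap (ModelRing (m i) (r i)) L (φ i (algebraMap ℂ _ c))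
      rw [AlgHom.commutes, ← IsScalarTower.algebraMap_apply]
    rw [RingHom.comp_apply, RingHom.comp_apply, h4]
    exact (e'.commutes _).symm
  rw [h3]
  exact RingHom.Smooth.comp h2 (RingHom.Smooth.of_bijective e'.bijective)

end Deformation

/-! ### Fibres of the models -/

lemma fibre_torusProjection_iso (n : ℕ) (c : ℂ) :
    Nonempty (fibre (torusProjection n) (fun _ => c) ≅ specOver (TorusRing n)) := by
  let π : MvPolynomial Unit (TorusRing n) →ₐ[ℂ] TorusRing n :=
    (MvPolynomial.aeval (R := TorusRing n) fun _ => algebraMap ℂ (TorusRing n) c).restrictScalars ℂ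
  refine fibre_iso_of_isPullback (isPullback_fibre (fun i : Unit => MvPolynomial.X i)
    (fun _ => c) π (fun x => ⟨MvPolynomial.C x, by simp [π]⟩) fun p => ?_)
  have := mem_span_X_sub_C_iff (J := Unit) (algebraMap ℂ (TorusRing n) c) p
  rw [Set.range_unique]
  refine Iff.trans ?_ this
  simp [π]

lemma fibre_modelMap_iso (m r : ℕ) (c : ℂ) :
    Nonempty (fibre (modelMap m r c) (fun _ => c) ≅ singularModel m r) := by
  refine fibre_iso_of_isPullback (isPullback_fibre _ _
    (Ideal.Quotient.mkₐ ℂ (Ideal.span {coordProd m r})) Ideal.Quotient.mk_surjective fun p => ?_)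
  rw [Set.range_unique, add_sub_cancel_left]
  exact Ideal.Quotient.eq_zero_iff_mem

lemma range_point_subset_lineMinus {k : ℕ} (ε : Fin k → ℂ) (s : Finset (Fin k)) (c : ℂ)
    (h : ∀ i ∈ s, c ≠ ε i) : Set.range (point fun _ : Unit => c) ⊆ lineMinus ε s := by
  refine range_point_subset _ _ ?_
  rw [map_prod, Finset.prod_ne_zero_iff]
  intro i hi
  simpa using sub_ne_zero.2 (h i hi)

end Altmann

end

theorem theorem4p1 {n k : ℕ} [NeZero k] (Q : Set (Fin n → ℝ)) (M : Fin k → Set (Fin n → ℝ))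
    (hQ : Q = ∑ i, M i) (hM : ∀ i, Altmann.IsUnimodularSimplex (M i))
    (ε : Fin k → ℂ) (hε0 : ε 0 = 0) (hε : Function.Injective ε) :
    -- the fibres of `Ψ` form a flat family, whose central fibre is the toric variety of `C(Q)`
    Flat (Altmann.Psi M) ∧
    Nonempty (Altmann.fibre (Altmann.Psi M) 0 ≅ Altmann.toricVariety (Altmann.coneOver Q)) ∧
    -- the general fibres of the projection to `t_1`
    (∀ c : ℂ, c ∉ Set.range ε →
      Nonempty (Altmann.fibre (Altmann.projection M ε) (fun _ => c) ≅
        Altmann.specOver (Altmann.TorusRing n))) ∧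
    -- over the complement of the `ε i` the projection is a trivial `(ℂ^*)^n`-bundle
    Nonempty (Over.mk (Altmann.projection M ε ∣_ Altmann.lineMinus ε Finset.univ) ≅
      Over.mk (Altmann.torusProjection n ∣_ Altmann.lineMinus ε Finset.univ)) ∧
    -- the fibre attached to `M i`
    (∀ i : Fin k, Nonempty (Altmann.fibre (Altmann.projection M ε) (fun _ => ε i) ≅
      Altmann.singularModel (Altmann.numVertices (M i)) (n - Altmann.numVertices (M i)))) ∧
    -- the local model of the projection near the fibre attached to `M i`
    (∀ i : Fin k, Nonempty
      (Over.mk (Altmann.projection M ε ∣_ Altmann.lineMinus ε (Finset.univ.erase i)) ≅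
        Over.mk (Altmann.modelMap (Altmann.numVertices (M i)) (n - Altmann.numVertices (M i)) (ε i)
          ∣_ Altmann.lineMinus ε (Finset.univ.erase i)))) ∧
    -- the singular fibres
    {c : ℂ | ¬ Smooth (Altmann.fibre (Altmann.projection M ε) (fun _ => c)).hom} =
      ε '' {i | M i ≠ {0}} ∧
    ((∀ i, M i ≠ {0}) →
      {c : ℂ | ¬ Smooth (Altmann.fibre (Altmann.projection M ε) (fun _ => c)).hom}.ncard = k) ∧
    -- the deformation is smooth
    Smooth (Altmann.deformation M ε).hom := by
  open Altmann in
  subst hQ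
  choose e he using fun i => (hM i).exists_coordinates
  let η : Fin k → (Fin n → ℤ) → ℕ := fun i u => Finset.univ.sup fun j => (-(e i u).1 j).toNat
  have hη : ∀ i, IsSupport (M i) (η i) := he
  let φ := fun i => modelHom hη ε (i := i) (e i) (fun _ => rfl)
  have hφt : ∀ i j, φ i (t M j) = modelCoord _ _ ε i j := fun i j => modelHom_t hη ε (e i) _ j
  have hφ : ∀ i j, φ i (t M 0) - φ i (t M j) = algebraMap ℂ _ (ε j) := by
    intro i j
    rw [hφt, hφt, modelCoord, modelCoord, add_sub_add_right_eq_sub, ← map_sub, hε0]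
    congr 1
    ring
  have hβ : ∀ i, (modelLaurent ε (e i) i).comp (φ i) = laurentHom hη (lineCoord ε) := fun i =>
    modelLaurent_comp_modelHom hη ε (e i) _
  have hg : ∀ i b, ∃ (N : ℕ) (a : ToricRing (cayleyCone M)),
      φ i (∏ j ∈ Finset.univ.erase i, t M j) ^ N * b = φ i a := fun i b =>
    modelHom_exists_pow_mul_eq hη ε (e i) _ b
  have hτt : ∀ j, torusHom hη ε (t M j) = MvPolynomial.X () - algebraMap ℂ _ (ε j) := fun j =>
    toricHom_t hη _ _ j
  have hτ : ∀ j, torusHom hη ε (t M 0) - torusHom hη ε (t M j) = algebraMap ℂ _ (ε j) := by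
    intro j
    rw [hτt, hτt, hε0, map_zero]
    ring
  have htorus : Nonempty (Over.mk (projection M ε ∣_ lineMinus ε Finset.univ) ≅
      Over.mk (torusProjection n ∣_ lineMinus ε Finset.univ)) := by
    have h := nonempty_restrict_projection_iso hη hε0 (torusHom hη ε) hτ torusLaurent
      (torusLaurent_comp_torusHom hη ε) Finset.univ (torusHom_exists_pow_mul_eq hη ε hε0)
    have h0 : (fun _ : Unit => torusHom hη ε (t M 0)) = fun i => MvPolynomial.X i := by
      funext i
      rw [hτt, hε0, map_zero, sub_zero]
    rw [h0] at h
    exact h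
  have hmodel : ∀ i : Fin k, Nonempty (Over.mk (projection M ε ∣_ lineMinus ε (Finset.univ.erase i))
      ≅ Over.mk (modelMap (numVertices (M i)) (n - numVertices (M i)) (ε i)
          ∣_ lineMinus ε (Finset.univ.erase i))) := by
    intro i
    have h := nonempty_restrict_projection_iso hη hε0 (φ i) (hφ i) (modelLaurent ε (e i) i) (hβ i)
      (Finset.univ.erase i) (hg i)
    have h0 : (fun _ : Unit => φ i (t M 0)) = fun _ => algebraMap ℂ _ (ε i) + coordProd _ _ := by
      funext _
      rw [hφt, modelCoord, hε0, sub_zero]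
    rw [h0] at h
    exact h
  have hgen : ∀ c : ℂ, c ∉ Set.range ε →
      Nonempty (fibre (projection M ε) (fun _ => c) ≅ specOver (TorusRing n)) := by
    intro c hc
    obtain ⟨e1⟩ := htorus
    obtain ⟨e2⟩ := fibre_iso_of_restrict_iso _ _ _ e1 (fun _ => c)
      (range_point_subset_lineMinus ε _ c fun i _ h => hc ⟨i, h.symm⟩)
    obtain ⟨e3⟩ := fibre_torusProjection_iso n c
    exact ⟨e2 ≪≫ e3⟩
  have hspec : ∀ i : Fin k, Nonempty (fibre (projection M ε) (fun _ => ε i) ≅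
      singularModel (numVertices (M i)) (n - numVertices (M i))) := by
    intro i
    obtain ⟨e1⟩ := hmodel i
    obtain ⟨e2⟩ := fibre_iso_of_restrict_iso _ _ _ e1 (fun _ => ε i)
      (range_point_subset_lineMinus ε _ _ fun j hj => hε.ne (Finset.ne_of_mem_erase hj).symm)
    obtain ⟨e3⟩ := fibre_modelMap_iso (numVertices (M i)) (n - numVertices (M i)) (ε i)
    exact ⟨e2 ≪≫ e3⟩
  have hsing : {c : ℂ | ¬ Smooth (fibre (projection M ε) (fun _ => c)).hom} =
      ε '' {i | M i ≠ {0}} := by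
    ext c
    constructor
    · intro hc
      by_cases hr : c ∈ Set.range ε
      · obtain ⟨i, rfl⟩ := hr
        refine ⟨i, fun h0 => hc ?_, rfl⟩
        have hm : numVertices (M i) = 0 := by
          by_contra h
          exact (hM i).ne_singleton_iff.2 h h0
        obtain ⟨e1⟩ := hspec i
        rw [hm] at e1
        exact (smooth_iff_of_iso e1).2 ((smooth_specOver_iff _).2 (smooth_singularModel_zero _))
      · obtain ⟨e1⟩ := hgen c hr
        exact absurd ((smooth_iff_of_iso e1).2 ((smooth_specOver_iff _).2 inferInstance)) hc
    · rintro ⟨i, hi, rfl⟩ hs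
      obtain ⟨e1⟩ := hspec i
      exact not_smooth_singularModel ((hM i).ne_singleton_iff.1 hi) _
        ((smooth_specOver_iff _).1 ((smooth_iff_of_iso e1).1 hs))
  refine ⟨flat_Psi hη, ?_, hgen, htorus, hspec, hmodel, hsing, fun h => ?_,
    smooth_deformation hη hε0 hε _ _ φ hφ _ hβ hg⟩
  · exact fibre_iso_of_isPullback (isPullback_fibre (fun i : {i : Fin k // i ≠ 0} => t M 0 - t M i.1)
      0 (centralHom hη) (centralHom_surjective hη) (ker_centralHom hη))
  · rw [hsing, Set.ncard_image_of_injective _ hε]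
    have : {i | M i ≠ {0}} = Set.univ := Set.eq_univ_of_forall h
    rw [this, Set.ncard_univ, Nat.card_eq_fintype_card, Fintype.card_fin]
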